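/- Let $q\in L^1_{\mathrm{loc}}(\mathbb R)$ be real valued and even, $q(x)=q(-x)$ for all $x\in\mathbb R$, and let $\tau_q(y)=-y''-qy$. Assume that $\tau_q$ is in the limit circle case at $+\infty$ and at $-\infty$: for every $\lambda\in\mathbb C$, every solution $y$ (with $y,y'\in AC_{\mathrm{loc}}(\mathbb R)$) of $\tau_q(y)-\lambda y=0$ belongs to $L^2((a,\infty))$ and to $L^2((-\infty,b))$ for some $a,b\in\mathbb R$. Let $A_{\max}$ be the maximal operator in $L^2(\mathbb R)$, $A_{\max}y=\tau_q(y)$ on $\{y\in L^2(\mathbb R): y,y'\in AC_{\mathrm{loc}}(\mathbb R),\ \tau_q(y)\in L^2(\mathbb R)\}$, let $A_0$ be its restriction to the compactly supported functions in its domain, and let $A=\overline{A_0}$ be the minimal operator. For $r\in\mathbb N$, an $r$-dimensional bi-extension of $A$ is a closed operator $\widetilde A$ with $A\subset\widetilde A\subset A^*$ and $\dim(\operatorname{dom}\widetilde A/\operatorname{dom}A)=r$. A closed densely defined operator $T$ in $L^2(\mathbb R)$ is called $\mathcal{PT}$-symmetric if for all $f\in\operatorname{dom}T$ one has $\mathcal{PT}f\in\operatorname{dom}T$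 and $\mathcal{PT}\,Tf=T\,\mathcal{PT}f$, where $(\mathcal{PT}f)(x)=\overline{f(-x)}$. Then every $1$-dimensional bi-extension $\widetilde A$ of $A$ satisfies $\sigma(\widetilde A)=\mathbb C$; moreover, its adjoint $\widetilde A^*$ is a $3$-dimensional bi-extension of $A$ with empty resolvent set. In particular, there exist $\mathcal{PT}$-symmetric $1$-dimensional bi-extensions of $A$ with empty resolvent set. -/

import Mathlib

open MeasureTheory Set

open scoped LinearPMap

namespace PTSymmetric

noncomputable section

/-- The Hilbert space `L²(ℝ)` of complex valued square integrable functions. -/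
abbrev L2R : Type := Lp ℂ 2 (volume : Measure ℝ)

section AbstractOperators

variable {H : Type*} [NormedAddCommGroup H] [InnerProductSpace ℂ H]

/-- The resolvent set of an unbounded operator `T` in `H`: the complex numbers `z` for which
`T - z : dom T → H` has an everywhere defined bounded two-sided inverse. -/
def resolventSet (T : H →ₗ.[ℂ] H) : Set ℂ :=
  {z | ∃ R : H →L[ℂ] H,
    (∀ x : H, ∃ h : R x ∈ T.domain, T ⟨R x, h⟩ - z • R x = x) ∧
    ∀ u : T.domain, R (T u - z • (u : H)) = u}

/-- The spectrum of an unbounded operator. -/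
def spectrum (T : H →ₗ.[ℂ] H) : Set ℂ := (resolventSet T)ᶜ

/-- `B` is a bi-extension of `A`: a closed operator with `A ⊆ B ⊆ A*`. -/
def IsBiExtension [CompleteSpace H] (A B : H →ₗ.[ℂ] H) : Prop :=
  B.IsClosed ∧ A ≤ B ∧ B ≤ A†

/-- `B` is an `r`-dimensional bi-extension of `A`: moreover `dim (dom B / dom A) = r`. -/
def IsBiExtensionOfDim [CompleteSpace H] (A B : H →ₗ.[ℂ] H) (r : ℕ) : Prop :=
  IsBiExtension A B ∧
    Module.rank ℂ (B.domain ⧸ A.domain.comap B.domain.subtype) = (r : Cardinal)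

end AbstractOperators

/-- Parity reflection `(P f)(x) = f(-x)` on `L²(ℝ)`. -/
def parity (f : L2R) : L2R :=
  Lp.compMeasurePreserving (fun x : ℝ => -x) (Measure.measurePreserving_neg volume) f

/-- Time reversal `(T f)(x) = conj (f x)` on `L²(ℝ)`. -/
def timeReversal (f : L2R) : L2R := star f

/-- The antilinear operator `PT` on `L²(ℝ)`. -/
def pt (f : L2R) : L2R := parity (timeReversal f)

/-- A closed densely defined operator `T` in `L²(ℝ)` is `PT`-symmetric if `PT f ∈ dom T` and
`PT (T f) = T (PT f)` for all `f ∈ dom T`. -/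
def IsPTSymmetric (T : L2R →ₗ.[ℂ] L2R) : Prop :=
  T.IsClosed ∧ Dense (T.domain : Set L2R) ∧
    ∀ f : T.domain, ∃ h : pt f ∈ T.domain, pt (T f) = T ⟨pt f, h⟩

/-- `AC_loc(ℝ)`: complex functions that are absolutely continuous on all compact intervals. -/
def ACloc (y : ℝ → ℂ) : Prop := ∀ a b : ℝ, AbsolutelyContinuousOnInterval y a b

/-- `y, y' ∈ AC_loc(ℝ)`. -/
structure IsRegular (y : ℝ → ℂ) : Prop where
  differentiable : Differentiable ℝ y
  acloc : ACloc y
  acloc_deriv : ACloc (deriv y)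

/-- The differential expression `τ_q(y) = -y'' - q y`; for regular `y` it is meaningful at almost
every point. -/
def tau (q : ℝ → ℝ) (y : ℝ → ℂ) : ℝ → ℂ := fun x => -deriv (deriv y) x - (q x : ℂ) * y x

/-- `y` is a solution on `ℝ` of `τ_q(y) - z y = 0`. -/
def IsSolution (q : ℝ → ℝ) (z : ℂ) (y : ℝ → ℂ) : Prop :=
  IsRegular y ∧ ∀ᵐ x : ℝ, tau q y x - z * y x = 0

/-- `τ_q` is in the limit circle case at `+∞`. -/
def LimitCircleAtTop (q : ℝ → ℝ) : Prop :=
  ∀ (z : ℂ) (y : ℝ → ℂ), IsSolution q z y → ∃ a : ℝ, MemLp y 2 (volume.restrict (Ioi a))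

/-- `τ_q` is in the limit circle case at `-∞`. -/
def LimitCircleAtBot (q : ℝ → ℝ) : Prop :=
  ∀ (z : ℂ) (y : ℝ → ℂ), IsSolution q z y → ∃ a : ℝ, MemLp y 2 (volume.restrict (Iio a))

theorem IsRegular.ae_differentiableAt {y : ℝ → ℂ} (hy : IsRegular y) :
    ∀ᵐ x : ℝ, DifferentiableAt ℝ (deriv y) x := by
  have h : ∀ n : ℕ, ∀ᵐ x : ℝ, x ∈ uIcc (-(n : ℝ)) n → DifferentiableAt ℝ (deriv y) x := fun n =>
    (hy.acloc_deriv _ _).boundedVariationOn.ae_differentiableAt_of_mem_uIcc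
  filter_upwards [ae_all_iff.2 h] with x hx
  obtain ⟨n, hn⟩ := exists_nat_ge |x|
  exact hx n (by rw [uIcc_of_le (by linarith [abs_nonneg x])]; exact abs_le.1 hn)

theorem IsRegular.zero : IsRegular (0 : ℝ → ℂ) := by
  have h : ACloc (0 : ℝ → ℂ) := fun a b =>
    (contDiff_const (c := (0 : ℂ))).contDiffOn.absolutelyContinuousOnInterval
  refine ⟨differentiable_const (0 : ℂ), h, ?_⟩
  rwa [show deriv (0 : ℝ → ℂ) = 0 from funext fun x => deriv_const x (0 : ℂ)]

theorem IsRegular.add {y w : ℝ → ℂ} (hy : IsRegular y) (hw : IsRegular w) :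
    IsRegular (y + w) := by
  refine ⟨hy.1.add hw.1, fun a b => (hy.2 a b).add (hw.2 a b), ?_⟩
  rw [show deriv (y + w) = deriv y + deriv w from funext fun x => deriv_add (hy.1 x) (hw.1 x)]
  exact fun a b => (hy.3 a b).add (hw.3 a b)

theorem IsRegular.smul {y : ℝ → ℂ} (c : ℂ) (hy : IsRegular y) : IsRegular (c • y) := by
  refine ⟨hy.1.const_smul c, fun a b => (hy.2 a b).const_smul c, ?_⟩
  rw [show deriv (c • y) = c • deriv y from funext fun x => deriv_const_smul c (hy.1 x)]
  exact fun a b => (hy.3 a b).const_smul c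

theorem tau_zero (q : ℝ → ℝ) : tau q 0 = 0 := by
  have h : deriv (0 : ℝ → ℂ) = 0 := funext fun x => deriv_const x (0 : ℂ)
  funext x
  simp [tau, h]

theorem tau_add (q : ℝ → ℝ) {y w : ℝ → ℂ} (hy : IsRegular y) (hw : IsRegular w) :
    tau q (y + w) =ᵐ[volume] tau q y + tau q w := by
  filter_upwards [hy.ae_differentiableAt, hw.ae_differentiableAt] with x h1 h2
  have h : deriv (y + w) = deriv y + deriv w := funext fun x => deriv_add (hy.1 x) (hw.1 x)
  simp only [tau, h, Pi.add_apply, deriv_add h1 h2]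
  ring

theorem tau_smul (q : ℝ → ℝ) (c : ℂ) {y : ℝ → ℂ} (hy : IsRegular y) :
    tau q (c • y) =ᵐ[volume] c • tau q y := by
  filter_upwards [hy.ae_differentiableAt] with x h1
  have h : deriv (c • y) = c • deriv y := funext fun x => deriv_const_smul c (hy.1 x)
  simp only [tau, h, Pi.smul_apply, deriv_const_smul c h1, smul_eq_mul]
  ring

/-- The graph of the maximal operator: all pairs `(y, τ_q y)` with `y, y' ∈ AC_loc(ℝ)` and
`y, τ_q y ∈ L²(ℝ)`, the functions being identified with their classes in `L²(ℝ)`. -/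
def maximalGraph (q : ℝ → ℝ) : Submodule ℂ (L2R × L2R) where
  carrier := {p | ∃ y : ℝ → ℂ, IsRegular y ∧ p.1 =ᵐ[volume] y ∧ p.2 =ᵐ[volume] tau q y}
  zero_mem' := ⟨0, IsRegular.zero, Lp.coeFn_zero _ _ _, by
    rw [tau_zero]
    exact Lp.coeFn_zero _ _ _⟩
  add_mem' := by
    rintro p r ⟨y, hy, h1, h2⟩ ⟨w, hw, h3, h4⟩
    exact ⟨y + w, hy.add hw, (Lp.coeFn_add _ _).trans (h1.add h3),
      ((Lp.coeFn_add _ _).trans (h2.add h4)).trans (tau_add q hy hw).symm⟩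
  smul_mem' := by
    rintro c p ⟨y, hy, h1, h2⟩
    exact ⟨c • y, hy.smul c, (Lp.coeFn_smul _ _).trans (h1.const_smul c),
      ((Lp.coeFn_smul _ _).trans (h2.const_smul c)).trans (tau_smul q c hy).symm⟩

theorem maximalGraph_snd_eq_zero (q : ℝ → ℝ) (p : L2R × L2R) (hp : p ∈ maximalGraph q)
    (h0 : p.1 = 0) : p.2 = 0 := by
  obtain ⟨y, hy, h1, h2⟩ := hp
  have hy0 : y = 0 := by
    refine (Continuous.ae_eq_iff_eq volume hy.1.continuous continuous_zero).1 ?_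
    rw [h0] at h1
    exact h1.symm.trans (Lp.coeFn_zero _ _ _)
  rw [hy0, tau_zero] at h2
  exact Lp.ext (h2.trans (Lp.coeFn_zero _ _ _).symm)

/-- The maximal operator `A_max y = τ_q(y)`, defined on all `y ∈ L²(ℝ)` with
`y, y' ∈ AC_loc(ℝ)` and `τ_q y ∈ L²(ℝ)`. -/
def maximalOperator (q : ℝ → ℝ) : L2R →ₗ.[ℂ] L2R := (maximalGraph q).toLinearPMap

theorem maximalOperator_graph (q : ℝ → ℝ) : (maximalOperator q).graph = maximalGraph q :=
  Submodule.toLinearPMap_graph_eq _ fun p hp h0 => maximalGraph_snd_eq_zero q p hp h0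

/-- The (classes of) functions `y` with `y, y' ∈ AC_loc(ℝ)` and compact support. -/
def compactlySupportedRegular : Submodule ℂ L2R where
  carrier := {f | ∃ y : ℝ → ℂ, IsRegular y ∧ HasCompactSupport y ∧ f =ᵐ[volume] y}
  zero_mem' := ⟨0, IsRegular.zero, HasCompactSupport.zero, Lp.coeFn_zero _ _ _⟩
  add_mem' := by
    rintro f g ⟨y, hy, hyc, h1⟩ ⟨w, hw, hwc, h2⟩
    exact ⟨y + w, hy.add hw, hyc.add hwc, (Lp.coeFn_add _ _).trans (h1.add h2)⟩
  smul_mem' := by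
    rintro c f ⟨y, hy, hyc, h1⟩
    exact ⟨c • y, hy.smul c, hyc.smul_left (f := fun _ => c),
      (Lp.coeFn_smul _ _).trans (h1.const_smul c)⟩

/-- The pre-minimal operator `A₀`: the restriction of the maximal operator to the functions of its
domain that have compact support. -/
def preminimalOperator (q : ℝ → ℝ) : L2R →ₗ.[ℂ] L2R :=
  (maximalOperator q).domRestrict compactlySupportedRegular

/-- The minimal operator `A`: the closure of the pre-minimal operator. -/
def minimalOperator (q : ℝ → ℝ) : L2R →ₗ.[ℂ] L2R := (preminimalOperator q).closure

end

end PTSymmetric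

/-! ### Local absolute continuity and the fundamental theorem of calculus -/

namespace PTSymmetric

open Filter Topology AbsolutelyContinuousOnInterval

/-! The minimal operator `A` is closed, densely defined and symmetric, and the limit circle
condition at both ends gives `dim ker (A* - z) = 2` for every complex `z`. The spectral statements
then follow by linear algebra (`one_dimensional_biExtension`).

A one-dimensional bi-extension `B` adds a single pair `(v, w)` to the graph of `A`. The range of `A
- z` is orthogonal to the two-dimensional space `ker (A* - z̄)`, and the range of `B - z` is larger
by at most the vector `w - z v`. So some nonzero `k` is orthogonal to the range of `B - z`, which is
therefore never onto. Dually, `B*` is `A*` cut down by the one condition `⟨w, x⟩ = ⟨v, A* x⟩`, so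
its domain meets each `ker (A* - z)` nontrivially and every `z` is an eigenvalue. By von Neumann's
formula `dom A* / dom A` has dimension `2 + 2`; the condition is nontrivial because `A = A**` and `v
∉ dom A`, which leaves dimension 3.

The deficiency count (`finrank_deficiencySpace_minimalOperator`) needs no description of `A*` as the
maximal operator. Lagrange's identity puts the two square integrable solutions into the deficiency
space. Conversely, a continuous compactly supported `f` orthogonal to both solutions lies, by
variation of constants, in the range of `A₀ - z̄`, hence is orthogonal to the deficiency space;
density then leaves only the span of the solutions.

For the existence claim, evenness of `q` makes `PT` commute with `A`, hence with `A*`. Since `PT` is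
an antilinear involution, `dom A*` has a `PT`-fixed vector outside `dom A`; adjoining it gives the
extension. -/

theorem absolutelyContinuousOnInterval_of_dist_le {X Y : Type*} [PseudoMetricSpace X]
    [PseudoMetricSpace Y] {f : ℝ → X} {g : ℝ → Y} {a b : ℝ} (K : ℝ)
    (hg : AbsolutelyContinuousOnInterval g a b)
    (h : ∀ x ∈ uIcc a b, ∀ y ∈ uIcc a b, dist (f x) (f y) ≤ K * dist (g x) (g y)) :
    AbsolutelyContinuousOnInterval f a b := by
  unfold AbsolutelyContinuousOnInterval at hg ⊢
  refine squeeze_zero' (Eventually.of_forall fun _ => Finset.sum_nonneg fun i hi => dist_nonneg) ?_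
    (by simpa using hg.const_mul K)
  rw [eventually_inf_principal]
  filter_upwards with E hE
  rw [Finset.mul_sum]
  exact Finset.sum_le_sum fun i hi => h _ (hE.1 i hi).1 _ (hE.1 i hi).2

theorem absolutelyContinuousOnInterval_comp_neg {X : Type*} [PseudoMetricSpace X]
    {f : ℝ → X} {a b : ℝ} (hf : AbsolutelyContinuousOnInterval f (-a) (-b)) :
    AbsolutelyContinuousOnInterval (fun x => f (-x)) a b := by
  rw [absolutelyContinuousOnInterval_iff] at hf ⊢
  intro ε hε
  obtain ⟨δ, hδ, h⟩ := hf ε hε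
  refine ⟨δ, hδ, fun E hE hlen => ?_⟩
  have hmem : ∀ x, x ∈ uIcc a b → -x ∈ uIcc (-a) (-b) := fun x hx => by
    rw [mem_uIcc] at hx ⊢
    rcases hx with hx | hx
    · right; constructor <;> linarith
    · left; constructor <;> linarith
  refine h (E.1, fun i => (-(E.2 i).1, -(E.2 i).2)) ⟨fun i hi => ?_, ?_⟩ ?_
  · exact ⟨hmem _ (hE.1 i hi).1, hmem _ (hE.1 i hi).2⟩
  · intro i hi j hj hij
    have := hE.2 hi hj hij
    -- Disjointness of half-open intervals is an inequality between a minimum of right ends and a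
    -- maximum of left ends, which negation preserves; that reflection moves the closed end does no
    -- harm.
    simp only [Function.onFun, uIoc, Ioc_disjoint_Ioc, max_neg_neg, min_neg_neg, neg_le_neg_iff]
      at this ⊢
    exact this
  · simpa [dist_neg_neg] using hlen

theorem ACloc.continuous {f : ℝ → ℂ} (hf : ACloc f) : Continuous f := by
  rw [continuous_iff_continuousAt]
  intro x
  refine (hf (x - 1) (x + 1)).continuousOn.continuousAt ?_
  rw [uIcc_of_le (by linarith)]
  exact Icc_mem_nhds (by linarith) (by linarith)

theorem ACloc.add {f g : ℝ → ℂ} (hf : ACloc f) (hg : ACloc g) : ACloc (fun x => f x + g x) :=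
  fun a b => (hf a b).add (hg a b)

theorem ACloc.sub {f g : ℝ → ℂ} (hf : ACloc f) (hg : ACloc g) : ACloc (fun x => f x - g x) :=
  fun a b => (hf a b).sub (hg a b)

theorem ACloc.mul {f g : ℝ → ℂ} (hf : ACloc f) (hg : ACloc g) : ACloc (fun x => f x * g x) :=
  fun a b => (hf a b).smul (hg a b)

theorem ACloc.neg {f : ℝ → ℂ} (hf : ACloc f) : ACloc (fun x => -f x) :=
  fun a b => (hf a b).neg

theorem ACloc.star {f : ℝ → ℂ} (hf : ACloc f) : ACloc (fun x => star (f x)) := fun a b =>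
  absolutelyContinuousOnInterval_of_dist_le 1 (hf a b) fun x _ y _ => by
    rw [one_mul, dist_eq_norm, dist_eq_norm, ← star_sub, norm_star]

theorem ACloc.comp_neg {f : ℝ → ℂ} (hf : ACloc f) : ACloc (fun x => f (-x)) := fun a b =>
  absolutelyContinuousOnInterval_comp_neg (hf (-a) (-b))

theorem ACloc.of_contDiff {f : ℝ → ℂ} (hf : ContDiff ℝ 1 f) : ACloc f := fun _ _ =>
  hf.contDiffOn.absolutelyContinuousOnInterval

theorem ACloc.eq_of_ae_hasDerivAt_zero {f : ℝ → ℂ} (hf : ACloc f)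
    (h : ∀ᵐ x, HasDerivAt f 0 x) (a b : ℝ) : f a = f b := by
  obtain ⟨C, hC⟩ := (hf a b).const_of_ae_hasDerivAt_zero (h.mono fun x hx _ => hx)
  rw [hC a left_mem_uIcc, hC b right_mem_uIcc]

theorem intervalIntegrable_of_locallyIntegrable {E : Type*} [NormedAddCommGroup E] {f : ℝ → E}
    (hf : LocallyIntegrable f volume) (a b : ℝ) : IntervalIntegrable f volume a b :=
  intervalIntegrable_iff.mpr
    ((hf.integrableOn_isCompact isCompact_uIcc).mono_set uIoc_subset_uIcc)

/-- Increments of the primitive are dominated by those of the real primitive of `‖f‖`, and they do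
not depend on the base point `c`. -/
theorem ACloc.integral {f : ℝ → ℂ} (hf : LocallyIntegrable f volume) (c : ℝ) :
    ACloc (fun x => ∫ t in c..x, f t) := fun a b => by
  have hi := intervalIntegrable_of_locallyIntegrable hf
  have key : AbsolutelyContinuousOnInterval (fun x => ∫ t in a..x, ‖f t‖) a b :=
    (hi a b).norm.absolutelyContinuousOnInterval_intervalIntegral left_mem_uIcc
  refine absolutelyContinuousOnInterval_of_dist_le 1 key fun x _ y _ => ?_
  rw [one_mul, dist_eq_norm, Real.dist_eq, intervalIntegral.integral_interval_sub_left (hi _ _)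
    (hi _ _), intervalIntegral.integral_interval_sub_left (hi _ _).norm (hi _ _).norm]
  exact intervalIntegral.norm_integral_le_abs_integral_norm

/-- Fundamental theorem of calculus for locally absolutely continuous complex functions. -/
theorem ACloc.integral_eq_sub {f g : ℝ → ℂ} (hf : ACloc f) (hg : LocallyIntegrable g volume)
    (h : ∀ᵐ x, HasDerivAt f (g x) x) (a b : ℝ) : ∫ t in a..b, g t = f b - f a := by
  have h1 : ACloc (fun x => f x - ∫ t in a..x, g t) := hf.sub (ACloc.integral hg a)
  have h2 : ∀ᵐ x, HasDerivAt (fun x => f x - ∫ t in a..x, g t) 0 x := by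
    filter_upwards [h, LocallyIntegrable.ae_hasDerivAt_integral hg] with x hx hx'
    have hd := hx.sub (hx' a)
    rw [sub_self] at hd
    exact hd
  have := h1.eq_of_ae_hasDerivAt_zero h2 a b
  simp only [intervalIntegral.integral_same, sub_zero] at this
  rw [this]; ring

theorem exists_bound_of_hasCompactSupport {g : ℝ → ℂ} (hc : HasCompactSupport g) :
    ∃ R : ℝ, 0 < R ∧ ∀ x, R ≤ |x| → g x = 0 := by
  obtain ⟨R, hR⟩ := hc.isCompact.isBounded.subset_closedBall 0
  refine ⟨max R 0 + 1, by positivity, fun x hx => ?_⟩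
  by_contra hne
  have := hR (subset_tsupport g hne)
  rw [mem_closedBall_zero_iff, Real.norm_eq_abs] at this
  linarith [le_max_left R 0]

theorem integral_eq_zero_of_hasDerivAt_of_hasCompactSupport {f g : ℝ → ℂ} (hf : ACloc f)
    (hg : Integrable g volume) (h : ∀ᵐ x, HasDerivAt f (g x) x) (hc : HasCompactSupport f) :
    ∫ t, g t = 0 := by
  have h1 := intervalIntegral_tendsto_integral hg tendsto_neg_atTop_atBot tendsto_id
  refine tendsto_nhds_unique h1 ((tendsto_congr' ?_).2 tendsto_const_nhds)
  obtain ⟨R, -, hz⟩ := exists_bound_of_hasCompactSupport hc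
  filter_upwards [eventually_ge_atTop R, eventually_ge_atTop 0] with x hx hx0
  simp only [id]
  rw [hf.integral_eq_sub hg.locallyIntegrable h, hz x (by rwa [abs_of_nonneg hx0]),
    hz (-x) (by rwa [abs_neg, abs_of_nonneg hx0]), sub_zero]

end PTSymmetric

/-! ### Global solutions for locally integrable coefficients -/

namespace PTSymmetric

open Filter Topology

/-- On the bounded range of the primitive the exponential is Lipschitz, so the composite is
absolutely continuous and the integral of its derivative is its increment. This is what lets an
exponential weight absorb a coefficient that is merely locally integrable. -/
theorem integral_mul_exp_primitive {m : ℝ → ℝ} (hm : LocallyIntegrable m volume) (c x : ℝ) :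
    ∫ t in (0 : ℝ)..x, c * m t * Real.exp (c * ∫ s in (0 : ℝ)..t, m s)
      = Real.exp (c * ∫ s in (0 : ℝ)..x, m s) - 1 := by
  set Q : ℝ → ℝ := fun x => ∫ s in (0 : ℝ)..x, m s with hQ
  have hAC : AbsolutelyContinuousOnInterval Q 0 x :=
    (intervalIntegrable_of_locallyIntegrable hm 0 x).absolutelyContinuousOnInterval_intervalIntegral
      left_mem_uIcc
  obtain ⟨R, hR⟩ := hAC.exists_bound
  have hcd : ContDiffOn ℝ 1 (fun y : ℝ => Real.exp (c * y)) (Icc (-R) R) := by fun_prop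
  obtain ⟨K, hK⟩ := hcd.exists_lipschitzOnWith (by decide) (convex_Icc _ _) isCompact_Icc
  have hE : AbsolutelyContinuousOnInterval (fun x => Real.exp (c * Q x)) 0 x :=
    absolutelyContinuousOnInterval_of_dist_le K hAC fun u hu v hv =>
      hK.dist_le_mul _ (abs_le.1 (hR u hu)) _ (abs_le.1 (hR v hv))
  have h0 : Q 0 = 0 := by simp [hQ]
  have := hE.integral_deriv_eq_sub
  simp only [h0, mul_zero, Real.exp_zero] at this
  rw [← this]
  refine intervalIntegral.integral_congr_ae ?_
  filter_upwards [LocallyIntegrable.ae_hasDerivAt_integral hm] with t ht _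
  rw [(((ht 0).const_mul c).exp).deriv]
  ring

/-- The vector field of the first order system equivalent to `y'' = -p y`. -/
noncomputable def systemField (p : ℝ → ℂ) (t : ℝ) (Y : ℂ × ℂ) : ℂ × ℂ := (Y.2, -(p t * Y.1))

theorem systemField_sub (p : ℝ → ℂ) (t : ℝ) (Y Z : ℂ × ℂ) :
    systemField p t (Y - Z) = systemField p t Y - systemField p t Z := by
  simp only [systemField, Prod.snd_sub, Prod.fst_sub, Prod.mk_sub_mk]
  congr 1; ring

theorem norm_systemField_le (p : ℝ → ℂ) (t : ℝ) (Y : ℂ × ℂ) :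
    ‖systemField p t Y‖ ≤ (1 + ‖p t‖) * ‖Y‖ := by
  have h1 := norm_fst_le Y
  have h2 := norm_snd_le Y
  have h3 := norm_nonneg (p t)
  have h4 := norm_nonneg Y
  refine (Prod.norm_mk _ _).trans_le (max_le ?_ ?_)
  · nlinarith
  · rw [norm_neg, norm_mul]; nlinarith

theorem locallyIntegrable_systemField {p : ℝ → ℂ} (hp : LocallyIntegrable p volume)
    {Y : ℝ → ℂ × ℂ} (hY : Continuous Y) :
    LocallyIntegrable (fun t => systemField p t (Y t)) volume := by
  rw [locallyIntegrable_iff]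
  intro k hk
  refine Integrable.prodMk ?_ ?_
  · exact (continuous_snd.comp hY).continuousOn.integrableOn_compact hk
  · exact ((hp.integrableOn_isCompact hk).mul_continuousOn
      (continuous_fst.comp hY).continuousOn hk).neg

/-- The system with locally integrable coefficients has a global solution: conjugated with an
exponential weight, the Picard map is a contraction of the bounded continuous functions. -/
theorem exists_integral_solution {p : ℝ → ℂ} (hp : LocallyIntegrable p volume) (Y₀ : ℂ × ℂ) :
    ∃ Y : ℝ → ℂ × ℂ, Continuous Y ∧
      ∀ x, Y x = Y₀ + ∫ t in (0 : ℝ)..x, systemField p t (Y t) := by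
  set m : ℝ → ℝ := fun t => 1 + ‖p t‖ with hm
  have hmi : LocallyIntegrable m volume := (locallyIntegrable_const 1).add fun x =>
    (hp x).imp fun s hs => ⟨hs.1, hs.2.norm⟩
  have hm0 : ∀ t, 0 ≤ m t := fun t => by positivity
  set Q : ℝ → ℝ := fun x => ∫ s in (0 : ℝ)..x, m s with hQ
  have hQc : Continuous Q :=
    intervalIntegral.continuous_primitive (intervalIntegrable_of_locallyIntegrable hmi) 0
  -- The factor 2 gives `|∫₀ˣ m W| = (W x - 1) / 2`, whence the contraction constant `1 / 2`; the
  -- absolute value treats both sides of the origin.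
  set W : ℝ → ℝ := fun x => Real.exp (2 * |Q x|) with hW
  have hWc : Continuous W := by fun_prop
  have hW0 : ∀ x, 0 < W x := fun x => Real.exp_pos _
  have hW1 : ∀ x, 1 ≤ W x := fun x => Real.one_le_exp (by positivity)
  have hmW : ∀ a b, IntervalIntegrable (fun t => m t * W t) volume a b := fun a b =>
    (intervalIntegrable_of_locallyIntegrable hmi a b).mul_continuousOn hWc.continuousOn
  have hint : ∀ x, |∫ t in (0 : ℝ)..x, m t * W t| ≤ W x / 2 := by
    intro x
    rcases le_total 0 x with hx | hx
    · have hQ0 : ∀ t, 0 ≤ t → 0 ≤ Q t := fun t ht =>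
        intervalIntegral.integral_nonneg ht fun s _ => hm0 s
      have h1 : ∫ t in (0 : ℝ)..x, m t * W t
          = (1 / 2) * ∫ t in (0 : ℝ)..x, 2 * m t * Real.exp (2 * Q t) := by
        rw [← intervalIntegral.integral_const_mul]
        refine intervalIntegral.integral_congr fun t ht => ?_
        rw [uIcc_of_le hx] at ht
        simp only [hW, abs_of_nonneg (hQ0 t ht.1)]
        ring
      rw [h1, integral_mul_exp_primitive hmi, abs_of_nonneg]
      · simp only [hW, abs_of_nonneg (hQ0 x hx)]
        linarith
      · have : 1 ≤ Real.exp (2 * Q x) := Real.one_le_exp (by have := hQ0 x hx; positivity)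
        simp only [hQ] at this
        linarith
    · have hQ0 : ∀ t, t ≤ 0 → Q t ≤ 0 := fun t ht => by
        simp only [hQ]
        rw [intervalIntegral.integral_symm, neg_nonpos]
        exact intervalIntegral.integral_nonneg ht fun s _ => hm0 s
      have h1 : ∫ t in (0 : ℝ)..x, m t * W t
          = -(1 / 2) * ∫ t in (0 : ℝ)..x, (-2) * m t * Real.exp ((-2) * Q t) := by
        rw [← intervalIntegral.integral_const_mul]
        refine intervalIntegral.integral_congr fun t ht => ?_
        rw [uIcc_of_ge hx] at ht
        simp only [hW, abs_of_nonpos (hQ0 t ht.2)]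
        ring_nf
      rw [h1, integral_mul_exp_primitive hmi, abs_of_nonpos]
      · simp only [hW, abs_of_nonpos (hQ0 x hx)]
        ring_nf
        simp only [hQ]
        linarith
      · have : 1 ≤ Real.exp ((-2) * Q x) := Real.one_le_exp (by have := hQ0 x hx; linarith)
        simp only [hQ] at this
        linarith
  have hest : ∀ (Z : ℝ → ℂ × ℂ) (C : ℝ), (∀ t, ‖Z t‖ ≤ C * W t) → ∀ x,
      ‖∫ t in (0 : ℝ)..x, systemField p t (Z t)‖ ≤ C * (W x / 2) := by
    intro Z C hZ x
    have hC : 0 ≤ C := by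
      have := (norm_nonneg _).trans (hZ 0)
      exact nonneg_of_mul_nonneg_left this (hW0 0)
    refine (intervalIntegral.norm_integral_le_abs_of_norm_le (g := fun t => C * (m t * W t))
      (ae_of_all _ fun t => ?_) ((hmW 0 x).const_mul C)).trans ?_
    · refine (norm_systemField_le p t (Z t)).trans ?_
      calc (1 + ‖p t‖) * ‖Z t‖ ≤ m t * (C * W t) := by gcongr; exact hZ t
        _ = C * (m t * W t) := by ring
    · rw [intervalIntegral.integral_const_mul, abs_mul, abs_of_nonneg hC]
      gcongr
      exact hint x
  have hLI : ∀ u : BoundedContinuousFunction ℝ (ℂ × ℂ),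
      LocallyIntegrable (fun t => systemField p t (W t • u t)) volume := fun u =>
    locallyIntegrable_systemField hp (hWc.smul u.continuous)
  have hII : ∀ (u : BoundedContinuousFunction ℝ (ℂ × ℂ)) (a b : ℝ),
      IntervalIntegrable (fun t => systemField p t (W t • u t)) volume a b := fun u a b =>
    intervalIntegrable_of_locallyIntegrable (hLI u) a b
  have hbd : ∀ (u : BoundedContinuousFunction ℝ (ℂ × ℂ)) (t : ℝ), ‖W t • u t‖ ≤ ‖u‖ * W t := by
    intro u t
    rw [norm_smul, Real.norm_of_nonneg (hW0 t).le, mul_comm]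
    gcongr
    exact u.norm_coe_le_norm t
  -- The unknown is `u = Y / W`, which stays bounded even when the solution `Y` grows.
  let T : BoundedContinuousFunction ℝ (ℂ × ℂ) → BoundedContinuousFunction ℝ (ℂ × ℂ) := fun u =>
    BoundedContinuousFunction.ofNormedAddCommGroup
      (fun x => (W x)⁻¹ • (Y₀ + ∫ t in (0 : ℝ)..x, systemField p t (W t • u t)))
      ((hWc.inv₀ fun x => (hW0 x).ne').smul
        (continuous_const.add (intervalIntegral.continuous_primitive (hII u) 0)))
      (‖Y₀‖ + ‖u‖ / 2) (fun x => by
        rw [norm_smul, norm_inv, Real.norm_of_nonneg (hW0 x).le, inv_mul_le_iff₀ (hW0 x)]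
        have h1 := hest _ _ (hbd u) x
        have h2 := norm_add_le Y₀ (∫ t in (0 : ℝ)..x, systemField p t (W t • u t))
        nlinarith [hW1 x, norm_nonneg Y₀])
  have hT : ∀ u x, T u x = (W x)⁻¹ • (Y₀ + ∫ t in (0 : ℝ)..x, systemField p t (W t • u t)) :=
    fun u x => rfl
  have hcontr : ContractingWith (1 / 2) T := by
    refine ⟨by norm_num, LipschitzWith.of_dist_le_mul fun u v => ?_⟩
    rw [BoundedContinuousFunction.dist_le (by positivity)]
    intro x
    rw [dist_eq_norm, hT, hT, ← smul_sub, add_sub_add_left_eq_sub,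
      ← intervalIntegral.integral_sub (hII u 0 x) (hII v 0 x)]
    simp only [← systemField_sub, ← smul_sub]
    rw [norm_smul, norm_inv, Real.norm_of_nonneg (hW0 x).le, inv_mul_le_iff₀ (hW0 x), dist_eq_norm]
    have := hest (fun t => W t • (u t - v t)) ‖u - v‖ (hbd (u - v)) x
    refine this.trans (le_of_eq ?_)
    push_cast
    ring
  set u := hcontr.fixedPoint T
  have hu : T u = u := hcontr.fixedPoint_isFixedPt
  refine ⟨fun x => W x • u x, hWc.smul u.continuous, fun x => ?_⟩
  have hx : u x = T u x := by rw [hu]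
  simp only
  conv_lhs => rw [hx, hT, smul_inv_smul₀ (hW0 x).ne']

theorem exists_solution {q : ℝ → ℝ} (hq : LocallyIntegrable q volume) (z a b : ℂ) :
    ∃ y : ℝ → ℂ, IsSolution q z y ∧ y 0 = a ∧ deriv y 0 = b := by
  -- The equation `-y'' - q y = z y` is `y'' = -(q + z) y`.
  set p : ℝ → ℂ := fun t => (q t : ℂ) + z with hp
  have hpi : LocallyIntegrable p volume := by
    refine LocallyIntegrable.add ?_ (locallyIntegrable_const z)
    rw [locallyIntegrable_iff]
    exact fun k hk => (hq.integrableOn_isCompact hk).ofReal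
  obtain ⟨Y, hYc, hY⟩ := exists_integral_solution hpi (a, b)
  have hLI := locallyIntegrable_systemField hpi hYc
  have hII := intervalIntegrable_of_locallyIntegrable hLI
  have h1 : ∀ x, (Y x).1 = a + ∫ t in (0 : ℝ)..x, (Y t).2 := by
    intro x
    conv_lhs => rw [hY x]
    rw [Prod.fst_add]
    congr 1
    exact ((ContinuousLinearMap.fst ℝ ℂ ℂ).intervalIntegral_comp_comm (hII 0 x)).symm
  have h2 : ∀ x, (Y x).2 = b + ∫ t in (0 : ℝ)..x, -(p t * (Y t).1) := by
    intro x
    conv_lhs => rw [hY x]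
    rw [Prod.snd_add]
    congr 1
    exact ((ContinuousLinearMap.snd ℝ ℂ ℂ).intervalIntegral_comp_comm (hII 0 x)).symm
  have hc2 : Continuous fun t => (Y t).2 := continuous_snd.comp hYc
  have hd1 : ∀ x, HasDerivAt (fun t => (Y t).1) (Y x).2 x := by
    intro x
    rw [show (fun t => (Y t).1) = fun x => a + ∫ t in (0 : ℝ)..x, (Y t).2 from funext h1]
    exact (hc2.integral_hasStrictDerivAt 0 x).hasDerivAt.const_add a
  have hderiv : deriv (fun t => (Y t).1) = fun t => (Y t).2 := funext fun x => (hd1 x).deriv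
  have hpY : LocallyIntegrable (fun t => -(p t * (Y t).1)) volume := by
    rw [locallyIntegrable_iff]
    exact fun k hk => ((hpi.integrableOn_isCompact hk).mul_continuousOn
      (continuous_fst.comp hYc).continuousOn hk).neg
  have hY2 : (fun t => (Y t).2) = fun x => b + ∫ t in (0 : ℝ)..x, -(p t * (Y t).1) := funext h2
  refine ⟨fun t => (Y t).1, ⟨⟨fun x => (hd1 x).differentiableAt, ?_, ?_⟩, ?_⟩, ?_, ?_⟩
  · refine ACloc.of_contDiff (contDiff_one_iff_deriv.2 ⟨fun x => (hd1 x).differentiableAt, ?_⟩)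
    rw [hderiv]
    exact hc2
  · rw [hderiv, hY2]
    exact (ACloc.of_contDiff contDiff_const).add (ACloc.integral hpY 0)
  · filter_upwards [LocallyIntegrable.ae_hasDerivAt_integral hpY] with x hx
    have hd2 : HasDerivAt (fun t => (Y t).2) (-(p x * (Y x).1)) x := by
      rw [hY2]
      exact (hx 0).const_add b
    simp only [tau, hderiv, hd2.deriv, hp]
    ring
  · simp [h1 0]
  · rw [hderiv]
    simp [h2 0]

end PTSymmetric

/-! ### Abstract extension theory inside the adjoint -/

namespace PTSymmetric

section AbstractExtensions

variable {H : Type*} [NormedAddCommGroup H] [InnerProductSpace ℂ H]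
  {A B : H →ₗ.[ℂ] H}

theorem dense_domain_of_le (hA : Dense (A.domain : Set H)) (h : A ≤ B) :
    Dense (B.domain : Set H) :=
  hA.mono h.1

theorem graph_le_of_le (h : A ≤ B) {p : H × H} (hp : p ∈ A.graph) : p ∈ B.graph :=
  LinearPMap.le_graph_of_le h hp

theorem mem_graph_of_mem_domain_of_le (h : A ≤ B) {x y : H} (hx : x ∈ A.domain)
    (hxy : (x, y) ∈ B.graph) : (x, y) ∈ A.graph := by
  obtain ⟨w, hw⟩ := LinearPMap.mem_domain_iff.1 hx
  rwa [B.mem_graph_snd_inj hxy (graph_le_of_le h hw) rfl]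

/-- An extension of dimension one is obtained by adjoining a single vector. -/
theorem exists_generator (hAB : A ≤ B)
    (hr : Module.rank ℂ (B.domain ⧸ A.domain.comap B.domain.subtype) = 1) :
    ∃ v w : H, (v, w) ∈ B.graph ∧ v ∉ A.domain ∧
      ∀ x y, (x, y) ∈ B.graph → ∃ c : ℂ, (x - c • v, y - c • w) ∈ A.graph := by
  let S := A.domain.comap B.domain.subtype
  obtain ⟨e, he, hspan⟩ := finrank_eq_one_iff'.1 (Module.rank_eq_one_iff_finrank_eq_one.1 hr)
  obtain ⟨v, rfl⟩ := S.mkQ_surjective e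
  refine ⟨v, B v, B.mem_graph v, fun hv => he ?_, fun x y hxy => ?_⟩
  · exact (Submodule.Quotient.mk_eq_zero S).2 hv
  · obtain ⟨c, hc⟩ := hspan (S.mkQ ⟨x, LinearPMap.mem_domain_of_mem_graph hxy⟩)
    refine ⟨c, mem_graph_of_mem_domain_of_le hAB ?_
      (B.graph.sub_mem hxy (B.graph.smul_mem c (B.mem_graph v)))⟩
    rw [← map_smul] at hc
    have := (Submodule.Quotient.eq S).1 hc.symm
    exact this

/-- One linear condition cannot annihilate a space of dimension at least two. Both resolvent
statements rest on this. -/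
theorem exists_mem_ne_zero_of_functional {N : Submodule ℂ H} (hN : 1 < Module.finrank ℂ N)
    (φ : H →ₗ[ℂ] ℂ) : ∃ k ∈ N, k ≠ 0 ∧ φ k = 0 := by
  have : FiniteDimensional ℂ N := Module.finite_of_finrank_pos (by omega)
  have h := LinearMap.ker_ne_bot_of_finrank_lt (f := φ ∘ₗ N.subtype)
    (by rwa [Module.finrank_self])
  obtain ⟨k, hk, hk0⟩ := Submodule.exists_mem_ne_zero_of_ne_bot h
  exact ⟨k, k.2, fun h0 => hk0 (Subtype.ext h0), hk⟩

variable [CompleteSpace H]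

theorem mem_graph_adjoint_iff (hA : Dense (A.domain : Set H)) {x y : H} :
    (x, y) ∈ A†.graph ↔ ∀ a b, (a, b) ∈ A.graph → inner ℂ b x = inner ℂ a y := by
  rw [LinearPMap.adjoint_graph_eq_graph_adjoint hA, Submodule.mem_adjoint_iff]
  simp only [sub_eq_zero]

theorem adjoint_le_adjoint (hA : Dense (A.domain : Set H)) (h : A ≤ B) : B† ≤ A† := by
  refine LinearPMap.le_of_le_graph ?_
  rintro ⟨x, y⟩ hxy
  rw [mem_graph_adjoint_iff (dense_domain_of_le hA h)] at hxy
  exact (mem_graph_adjoint_iff hA).2 fun a b hab => hxy a b (graph_le_of_le h hab)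

/-- Orthogonal decomposition along the graph of a closed operator. -/
theorem exists_graph_decomposition (hA : Dense (A.domain : Set H)) (hcl : A.IsClosed) (x y : H) :
    ∃ a b c d : H, (a, b) ∈ A.graph ∧ (d, -c) ∈ A†.graph ∧ x = a + c ∧ y = b + d := by
  -- The plain product carries the sup norm; orthogonality needs its `ℓ²` version, with the same
  -- topology.
  let e := WithLp.prodContinuousLinearEquiv 2 ℂ H H
  let G : Submodule ℂ (WithLp 2 (H × H)) := A.graph.comap e.toLinearMap
  have hGc : IsClosed (G : Set (WithLp 2 (H × H))) := hcl.preimage e.continuous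
  have : CompleteSpace G := hGc.completeSpace_coe
  obtain ⟨g, hg, p, hp, hgp⟩ := G.exists_add_mem_mem_orthogonal (WithLp.toLp 2 (x, y))
  refine ⟨(WithLp.ofLp g).1, (WithLp.ofLp g).2, (WithLp.ofLp p).1, (WithLp.ofLp p).2, hg, ?_,
    congrArg (fun w : WithLp 2 (H × H) => (WithLp.ofLp w).1) hgp,
    congrArg (fun w : WithLp 2 (H × H) => (WithLp.ofLp w).2) hgp⟩
  rw [mem_graph_adjoint_iff hA]
  intro a b hab
  have h := (Submodule.mem_orthogonal _ _).1 hp (WithLp.toLp 2 (a, b)) hab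
  rw [WithLp.prod_inner_apply] at h
  rw [inner_neg_right]
  exact eq_neg_of_add_eq_zero_right h

/-- A closed densely defined operator contains its second adjoint. -/
theorem mem_graph_of_forall_adjoint (hA : Dense (A.domain : Set H)) (hcl : A.IsClosed) {v w : H}
    (h : ∀ a b, (a, b) ∈ A†.graph → inner ℂ b v = inner ℂ a w) : (v, w) ∈ A.graph := by
  obtain ⟨a, b, c, d, hab, hdc, rfl, rfl⟩ := exists_graph_decomposition hA hcl v w
  have h1 := h _ _ hdc
  have h2 := (mem_graph_adjoint_iff hA).1 hdc a b hab
  have h3 : inner ℂ (-c) a = inner ℂ d b := by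
    rw [← inner_conj_symm, ← h2, inner_conj_symm]
  rw [inner_add_right, inner_add_right, h3, add_right_inj, inner_neg_left,
    inner_self_eq_norm_sq_to_K, inner_self_eq_norm_sq_to_K] at h1
  -- Tested against `(d, -c)`, the hypothesis loses its part along the graph of `A`, and the
  -- orthogonal remainder `(c, d)` is forced to vanish.
  have h4 : -‖c‖ ^ 2 = ‖d‖ ^ 2 := by exact_mod_cast h1
  have hc : c = 0 := norm_eq_zero.1 (by nlinarith [sq_nonneg ‖c‖, sq_nonneg ‖d‖])
  have hd : d = 0 := norm_eq_zero.1 (by nlinarith [sq_nonneg ‖c‖, sq_nonneg ‖d‖])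
  simpa [hc, hd] using hab

/-- The deficiency space `ker (A* - z)`. -/
noncomputable def deficiencySpace (A : H →ₗ.[ℂ] H) (z : ℂ) : Submodule ℂ H where
  carrier := {x | (x, z • x) ∈ A†.graph}
  zero_mem' := by
    rw [mem_ofPred_eq, smul_zero]
    exact A†.graph.zero_mem
  add_mem' := fun {x y} hx hy => by
    have := A†.graph.add_mem hx hy
    simpa only [mem_ofPred_eq, Prod.mk_add_mk, smul_add] using this
  smul_mem' := fun c x hx => by
    have := A†.graph.smul_mem c hx
    rwa [Prod.smul_mk, smul_comm] at this

theorem mem_deficiencySpace {z : ℂ} {x : H} :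
    x ∈ deficiencySpace A z ↔ (x, z • x) ∈ A†.graph := Iff.rfl

theorem deficiencySpace_le_domain (z : ℂ) : deficiencySpace A z ≤ A†.domain := fun _ hx =>
  LinearPMap.mem_domain_of_mem_graph hx

/-- Von Neumann's formula: the dimension of `dom A* / dom A`. -/
theorem rank_adjoint_domain_quotient (hA : Dense (A.domain : Set H)) (hcl : A.IsClosed)
    (hs : A ≤ A†) {n m : ℕ} (hn : Module.finrank ℂ (deficiencySpace A Complex.I) = n)
    (hm : Module.finrank ℂ (deficiencySpace A (-Complex.I)) = m)
    [FiniteDimensional ℂ (deficiencySpace A Complex.I)]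
    [FiniteDimensional ℂ (deficiencySpace A (-Complex.I))] :
    Module.rank ℂ (A†.domain ⧸ A.domain.comap A†.domain.subtype) = ((n + m : ℕ) : Cardinal) := by
  let S := A.domain.comap A†.domain.subtype
  let f : (deficiencySpace A Complex.I × deficiencySpace A (-Complex.I)) →ₗ[ℂ] A†.domain ⧸ S :=
    S.mkQ ∘ₗ (Submodule.inclusion (deficiencySpace_le_domain Complex.I)).coprod
      (Submodule.inclusion (deficiencySpace_le_domain (-Complex.I)))
  have hinj : Function.Injective f := by
    rw [injective_iff_map_eq_zero]
    rintro ⟨⟨u, hu⟩, ⟨w, hw⟩⟩ h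
    have hmem : u + w ∈ A.domain := (Submodule.Quotient.mk_eq_zero S).1 h
    -- Here `A (u + w) = i u - i w`. Pairing with `u`, and then with `w`, cancels the cross terms
    -- and leaves a nonzero multiple of the squared norm.
    have hsum := mem_graph_of_mem_domain_of_le hs hmem (A†.graph.add_mem hu hw)
    have h1 := (mem_graph_adjoint_iff hA).1 hu _ _ hsum
    have h2 := (mem_graph_adjoint_iff hA).1 hw _ _ hsum
    simp only [inner_add_left, inner_smul_left, inner_smul_right, map_neg, Complex.conj_I]
      at h1 h2
    have hu0 : inner ℂ u u = 0 := by
      have : Complex.I * (2 * inner ℂ u u) = 0 := by linear_combination -h1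
      simpa using this
    have hw0 : inner ℂ w w = 0 := by
      have : Complex.I * (2 * inner ℂ w w) = 0 := by linear_combination h2
      simpa using this
    rw [inner_self_eq_zero] at hu0 hw0
    subst hu0 hw0
    rfl
  have hsurj : Function.Surjective f := by
    intro c
    obtain ⟨⟨x, hx⟩, rfl⟩ := S.mkQ_surjective c
    obtain ⟨y, hxy⟩ := LinearPMap.mem_domain_iff.1 hx
    obtain ⟨a, b, c, d, hab, hdc, rfl, rfl⟩ := exists_graph_decomposition hA hcl x y
    have hcd : (c, d) ∈ A†.graph := by
      have := A†.graph.sub_mem hxy (graph_le_of_le hs hab)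
      simpa using this
    -- From `A* c = d` and `A* d = -c` follows `A* (c ∓ i d) = ± i (c ∓ i d)`, and half the sum of
    -- these two eigenvectors is `c`.
    have hI := Complex.I_mul_I
    have hu : (1 / 2 : ℂ) • (c - Complex.I • d) ∈ deficiencySpace A Complex.I := by
      refine Submodule.smul_mem _ _ ?_
      have := A†.graph.sub_mem hcd (A†.graph.smul_mem Complex.I hdc)
      rw [mem_deficiencySpace]
      convert! this using 1
      simp [smul_sub, smul_smul, hI, add_comm]
    have hw : (1 / 2 : ℂ) • (c + Complex.I • d) ∈ deficiencySpace A (-Complex.I) := by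
      refine Submodule.smul_mem _ _ ?_
      have := A†.graph.add_mem hcd (A†.graph.smul_mem Complex.I hdc)
      rw [mem_deficiencySpace]
      convert! this using 1
      simp [smul_smul, hI, add_comm]
    refine ⟨(⟨_, hu⟩, ⟨_, hw⟩), ?_⟩
    refine (Submodule.Quotient.eq S).2 ?_
    change (1 / 2 : ℂ) • (c - Complex.I • d) + (1 / 2 : ℂ) • (c + Complex.I • d) - (a + c)
      ∈ A.domain
    have : (1 / 2 : ℂ) • (c - Complex.I • d) + (1 / 2 : ℂ) • (c + Complex.I • d) - (a + c)
        = -a := by module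
    rw [this]
    exact A.domain.neg_mem (LinearPMap.mem_domain_of_mem_graph hab)
  rw [← (LinearEquiv.ofBijective f ⟨hinj, hsurj⟩).rank_eq, ← Module.finrank_eq_rank,
    Module.finrank_prod, hn, hm]

/-- Beyond the tests against `A` only the pairing with the added vector is new, so `B†` is cut out
of `A†` by one linear condition. -/
theorem mem_graph_adjoint_iff_of_generator (hA : Dense (A.domain : Set H)) (hAB : A ≤ B)
    {v w : H} (hvw : (v, w) ∈ B.graph)
    (hgen : ∀ x y, (x, y) ∈ B.graph → ∃ c : ℂ, (x - c • v, y - c • w) ∈ A.graph) {x y : H} :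
    (x, y) ∈ B†.graph ↔ (x, y) ∈ A†.graph ∧ inner ℂ w x = inner ℂ v y := by
  rw [mem_graph_adjoint_iff (dense_domain_of_le hA hAB), mem_graph_adjoint_iff hA]
  constructor
  · exact fun h => ⟨fun a b hab => h a b (graph_le_of_le hAB hab), h v w hvw⟩
  · rintro ⟨h1, h2⟩ a b hab
    obtain ⟨c, hc⟩ := hgen a b hab
    have h3 := h1 _ _ hc
    rw [inner_sub_left, inner_sub_left, inner_smul_left, inner_smul_left, h2] at h3
    exact sub_left_injective h3

/-- A one-dimensional extension of an operator with deficiency at least two has no resolvent. -/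
theorem resolventSet_eq_empty_of_generator (hA : Dense (A.domain : Set H))
    (hN : ∀ z, 1 < Module.finrank ℂ (deficiencySpace A z)) {v w : H}
    (hgen : ∀ x y, (x, y) ∈ B.graph → ∃ c : ℂ, (x - c • v, y - c • w) ∈ A.graph) :
    resolventSet B = ∅ := by
  refine eq_empty_of_forall_notMem ?_
  rintro z ⟨R, hR, -⟩
  -- Being in `ker (A* - z̄)`, `k` is orthogonal to the range of `A - z`; being also orthogonal to
  -- `w - z v`, it is orthogonal to the range of `B - z`, which should contain `k`.
  obtain ⟨k, hk, hk0, hφ⟩ := exists_mem_ne_zero_of_functional (hN (star z))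
    (innerSL ℂ (w - z • v)).toLinearMap
  obtain ⟨hdom, hx⟩ := hR k
  obtain ⟨c, hc⟩ := hgen _ _ (B.mem_graph ⟨R k, hdom⟩)
  have h1 := (mem_graph_adjoint_iff hA).1 (mem_deficiencySpace.1 hk) _ _ hc
  have h2 : inner ℂ (w - z • v) k = 0 := hφ
  apply hk0
  rw [← inner_self_eq_zero (𝕜 := ℂ)]
  have h3 : inner ℂ k k = inner ℂ (B ⟨R k, hdom⟩ - z • R k) k := by rw [hx]
  rw [h3]
  simp only [inner_sub_left, inner_smul_left, inner_smul_right, Complex.star_def] at h1 h2 ⊢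
  linear_combination h1 + (starRingEnd ℂ) c * h2

/-- The single condition defining `B†` has a nonzero solution in each deficiency space, so every `z`
is an eigenvalue. -/
theorem resolventSet_adjoint_eq_empty_of_generator (hA : Dense (A.domain : Set H)) (hAB : A ≤ B)
    (hN : ∀ z, 1 < Module.finrank ℂ (deficiencySpace A z)) {v w : H} (hvw : (v, w) ∈ B.graph)
    (hgen : ∀ x y, (x, y) ∈ B.graph → ∃ c : ℂ, (x - c • v, y - c • w) ∈ A.graph) :
    resolventSet B† = ∅ := by
  refine eq_empty_of_forall_notMem ?_
  rintro z ⟨R, -, hR⟩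
  obtain ⟨k, hk, hk0, hφ⟩ := exists_mem_ne_zero_of_functional (hN z)
    ((innerSL ℂ w).toLinearMap - z • (innerSL ℂ v).toLinearMap)
  have hkB : (k, z • k) ∈ B†.graph := by
    refine (mem_graph_adjoint_iff_of_generator hA hAB hvw hgen).2 ⟨hk, ?_⟩
    rw [inner_smul_right]
    exact sub_eq_zero.1 hφ
  have hdom := LinearPMap.mem_domain_of_mem_graph hkB
  have h := hR ⟨k, hdom⟩
  rw [← (LinearPMap.image_iff hdom).2 hkB, sub_self, map_zero] at h
  exact hk0 h.symm

/-- The condition defining `B†` descends to a functional on `dom A* / dom A`, whose kernel is `dom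
B* / dom A`. It is nonzero: otherwise `(v, w)` would belong to the graph of `A** = A`. -/
theorem rank_adjoint_of_generator (hA : Dense (A.domain : Set H)) (hcl : A.IsClosed)
    (hs : A ≤ A†) (hAB : A ≤ B) (hBA : B ≤ A†) {n : ℕ}
    (hrank : Module.rank ℂ (A†.domain ⧸ A.domain.comap A†.domain.subtype)
      = ((n + 1 : ℕ) : Cardinal)) {v w : H} (hvw : (v, w) ∈ B.graph) (hv : v ∉ A.domain)
    (hgen : ∀ x y, (x, y) ∈ B.graph → ∃ c : ℂ, (x - c • v, y - c • w) ∈ A.graph) :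
    Module.rank ℂ (B†.domain ⧸ A.domain.comap B†.domain.subtype) = (n : Cardinal) := by
  let S := A.domain.comap A†.domain.subtype
  have hBadj := adjoint_le_adjoint hA hAB
  have : FiniteDimensional ℂ (A†.domain ⧸ S) :=
    Module.rank_lt_aleph0_iff.1 (hrank ▸ Cardinal.natCast_lt_aleph0)
  have hfin : Module.finrank ℂ (A†.domain ⧸ S) = n + 1 := Module.finrank_eq_of_rank_eq hrank
  let φ : A†.domain →ₗ[ℂ] ℂ :=
    (innerSL ℂ w).toLinearMap ∘ₗ A†.domain.subtype - (innerSL ℂ v).toLinearMap ∘ₗ A†.toFun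
  have hφ : ∀ x : A†.domain, φ x = inner ℂ w (x : H) - inner ℂ v (A† x) := fun x => rfl
  have hφ0 : ∀ x : A†.domain, φ x = 0 ↔ (x : H) ∈ B†.domain := by
    intro x
    rw [hφ, sub_eq_zero]
    constructor
    · exact fun h => LinearPMap.mem_domain_of_mem_graph
        ((mem_graph_adjoint_iff_of_generator hA hAB hvw hgen).2 ⟨A†.mem_graph x, h⟩)
    · exact fun h => ((mem_graph_adjoint_iff_of_generator hA hAB hvw hgen).1
        (mem_graph_of_mem_domain_of_le hBadj h (A†.mem_graph x))).2
  have hSφ : S ≤ LinearMap.ker φ := by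
    intro x hx
    rw [LinearMap.mem_ker, hφ, sub_eq_zero]
    have h1 := mem_graph_of_mem_domain_of_le hs hx (A†.mem_graph x)
    have h2 : inner ℂ (A† x) v = inner ℂ (x : H) w :=
      (mem_graph_adjoint_iff hA).1 (graph_le_of_le hBA hvw) _ _ h1
    rw [← inner_conj_symm, ← h2, inner_conj_symm]
  let ψ : (A†.domain ⧸ S) →ₗ[ℂ] ℂ := S.liftQ φ hSφ
  have hψ : LinearMap.range ψ = ⊤ := by
    refine LinearMap.range_eq_top.2 (LinearMap.surjective fun h0 => hv ?_)
    refine LinearPMap.mem_domain_of_mem_graph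
      (mem_graph_of_forall_adjoint hA hcl (v := v) (w := w) fun a b hab => ?_)
    have ha := LinearPMap.mem_domain_of_mem_graph hab
    have h1 : φ ⟨a, ha⟩ = 0 := by
      have := congrArg (fun l => l (S.mkQ ⟨a, ha⟩)) h0
      simpa [ψ] using this
    rw [hφ, sub_eq_zero, ← (LinearPMap.image_iff ha).2 hab] at h1
    rw [← inner_conj_symm, ← h1, inner_conj_symm]
  have hker : Module.finrank ℂ (LinearMap.ker ψ) = n := by
    have := ψ.finrank_range_add_finrank_ker
    rw [hψ, finrank_top, Module.finrank_self, hfin] at this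
    omega
  let ι : B†.domain →ₗ[ℂ] A†.domain ⧸ S := S.mkQ ∘ₗ Submodule.inclusion hBadj.1
  have hιker : LinearMap.ker ι = A.domain.comap B†.domain.subtype := by
    ext x
    exact Submodule.Quotient.mk_eq_zero S
  have hιrange : LinearMap.range ι = LinearMap.ker ψ := by
    ext c
    obtain ⟨x, rfl⟩ := S.mkQ_surjective c
    rw [LinearMap.mem_ker, show ψ (S.mkQ x) = φ x from rfl, hφ0]
    constructor
    · rintro ⟨y, hy⟩
      have h1 : (y : H) - x ∈ A.domain := (Submodule.Quotient.eq S).1 hy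
      have h2 : (y : H) - x ∈ B†.domain := by
        refine (hφ0 ⟨(y : H) - x, A†.domain.sub_mem (hBadj.1 y.2) x.2⟩).1 (hSφ h1)
      simpa using B†.domain.sub_mem y.2 h2
    · exact fun hx => ⟨⟨x, hx⟩, rfl⟩
  rw [← ((Submodule.quotEquivOfEq _ _ hιker).symm.trans ι.quotKerEquivRange).symm.rank_eq, hιrange,
    ← Module.finrank_eq_rank, hker]

theorem le_adjoint_of_le_adjoint (hA : Dense (A.domain : Set H)) (hAB : A ≤ B) (hBA : B ≤ A†) :
    A ≤ B† := by
  refine LinearPMap.le_of_le_graph ?_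
  rintro ⟨a, b⟩ hab
  refine (mem_graph_adjoint_iff (dense_domain_of_le hA hAB)).2 fun x y hxy => ?_
  have := (mem_graph_adjoint_iff hA).1 (graph_le_of_le hBA hxy) a b hab
  rw [← inner_conj_symm, ← this, inner_conj_symm]

/-- One-dimensional bi-extensions of a symmetric operator with deficiency indices `(2, 2)`. -/
theorem one_dimensional_biExtension (hA : Dense (A.domain : Set H)) (hcl : A.IsClosed)
    (hs : A ≤ A†) (hN : ∀ z, Module.finrank ℂ (deficiencySpace A z) = 2)
    (hB : IsBiExtensionOfDim A B 1) :
    spectrum B = univ ∧ IsBiExtensionOfDim A B† 3 ∧ resolventSet B† = ∅ := by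
  obtain ⟨⟨-, hAB, hBA⟩, hr⟩ := hB
  obtain ⟨v, w, hvw, hv, hgen⟩ := exists_generator hAB (by simpa using hr)
  have hN' : ∀ z, 1 < Module.finrank ℂ (deficiencySpace A z) := fun z => by rw [hN z]; norm_num
  have : ∀ z, FiniteDimensional ℂ (deficiencySpace A z) := fun z =>
    Module.finite_of_finrank_pos (by rw [hN z]; norm_num)
  refine ⟨?_, ⟨⟨LinearPMap.adjoint_isClosed (dense_domain_of_le hA hAB),
    le_adjoint_of_le_adjoint hA hAB hBA, adjoint_le_adjoint hA hAB⟩, ?_⟩,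
    resolventSet_adjoint_eq_empty_of_generator hA hAB hN' hvw hgen⟩
  · rw [spectrum, resolventSet_eq_empty_of_generator hA hN' hgen, compl_empty]
  -- Von Neumann's `2 + 2` is read as `3 + 1`.
  · exact rank_adjoint_of_generator hA hcl hs hAB hBA
      (rank_adjoint_domain_quotient (n := 2) (m := 2) hA hcl hs (hN _) (hN _)) hvw hv hgen

/-- The extension of `A` inside `A*` obtained by adjoining one vector of `dom A*`. -/
theorem isBiExtensionOfDim_domRestrict (hcl : A.IsClosed) (hs : A ≤ A†) {v : H}
    (hvd : v ∈ A†.domain) (hv : v ∉ A.domain) :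
    IsBiExtensionOfDim A (A†.domRestrict (A.domain ⊔ Submodule.span ℂ {v})) 1 := by
  set B := A†.domRestrict (A.domain ⊔ Submodule.span ℂ {v}) with hB
  have hBA : B ≤ A† := LinearPMap.domRestrict_le
  have hdom : ∀ x, x ∈ B.domain ↔ x ∈ A.domain ⊔ Submodule.span ℂ {v} := by
    intro x
    rw [hB, LinearPMap.domRestrict_domain, Submodule.mem_inf]
    refine and_iff_left_of_imp fun hx => ?_
    exact (sup_le hs.1 ((Submodule.span_singleton_le_iff_mem _ _).2 hvd) :
      A.domain ⊔ Submodule.span ℂ {v} ≤ A†.domain) hx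
  obtain ⟨w, hvw⟩ := LinearPMap.mem_domain_iff.1 hvd
  have hvB : v ∈ B.domain := (hdom v).2 (Submodule.mem_sup_right (Submodule.mem_span_singleton_self v))
  have hAB : A ≤ B := by
    refine LinearPMap.le_of_le_graph ?_
    rintro ⟨a, b⟩ hab
    exact mem_graph_of_mem_domain_of_le hBA
      ((hdom a).2 (Submodule.mem_sup_left (LinearPMap.mem_domain_of_mem_graph hab)))
      (graph_le_of_le hs hab)
  -- A closed subspace plus a line is closed, which gives closedness of `B`.
  have hgraph : B.graph = A.graph ⊔ Submodule.span ℂ {(v, w)} := by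
    refine le_antisymm ?_ (sup_le (LinearPMap.le_graph_of_le hAB)
      ((Submodule.span_singleton_le_iff_mem _ _).2 (mem_graph_of_mem_domain_of_le hBA hvB hvw)))
    rintro ⟨x, y⟩ hxy
    obtain ⟨a, ha, u, hu, rfl⟩ :=
      Submodule.mem_sup.1 ((hdom x).1 (LinearPMap.mem_domain_of_mem_graph hxy))
    obtain ⟨c, rfl⟩ := Submodule.mem_span_singleton.1 hu
    refine Submodule.mem_sup.2 ⟨(a, y - c • w), ?_, c • (v, w),
      Submodule.smul_mem _ _ (Submodule.mem_span_singleton_self _), by simp⟩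
    refine mem_graph_of_mem_domain_of_le hs ha ?_
    have := A†.graph.sub_mem (graph_le_of_le hBA hxy) (A†.graph.smul_mem c hvw)
    simpa using this
  refine ⟨⟨?_, hAB, hBA⟩, ?_⟩
  · rw [LinearPMap.IsClosed, hgraph]
    exact Submodule.isClosed_sup_finiteDimensional _ _ hcl
  · rw [Nat.cast_one, Module.rank_eq_one_iff_finrank_eq_one, finrank_eq_one_iff']
    let S := A.domain.comap B.domain.subtype
    refine ⟨S.mkQ ⟨v, hvB⟩, fun h => hv ((Submodule.Quotient.mk_eq_zero S).1 h), fun c => ?_⟩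
    obtain ⟨⟨x, hx⟩, rfl⟩ := S.mkQ_surjective c
    obtain ⟨a, ha, u, hu, rfl⟩ := Submodule.mem_sup.1 ((hdom x).1 hx)
    obtain ⟨c, rfl⟩ := Submodule.mem_span_singleton.1 hu
    refine ⟨c, ?_⟩
    rw [← map_smul]
    refine (Submodule.Quotient.eq S).2 ?_
    change c • v - (a + c • v) ∈ A.domain
    rw [show c • v - (a + c • v) = -a by abel]
    exact A.domain.neg_mem ha

end AbstractExtensions

end PTSymmetric

/-! ### The minimal operator and its deficiency spaces -/

namespace PTSymmetric

open Filter Topology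

theorem IsRegular.hasDerivAt {y : ℝ → ℂ} (hy : IsRegular y) (x : ℝ) :
    HasDerivAt y (deriv y x) x := (hy.differentiable x).hasDerivAt

theorem IsRegular.ae_hasDerivAt_deriv {y : ℝ → ℂ} (hy : IsRegular y) :
    ∀ᵐ x : ℝ, HasDerivAt (deriv y) (deriv (deriv y) x) x :=
  hy.ae_differentiableAt.mono fun _ hx => hx.hasDerivAt

theorem IsRegular.of_hasDerivAt {y w : ℝ → ℂ} (h : ∀ x, HasDerivAt y (w x) x) (hw : ACloc w) :
    IsRegular y := by
  have hd : deriv y = w := funext fun x => (h x).deriv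
  have hdiff : Differentiable ℝ y := fun x => (h x).differentiableAt
  refine ⟨hdiff, ACloc.of_contDiff (contDiff_one_iff_deriv.2 ⟨hdiff, ?_⟩), by rwa [hd]⟩
  rw [hd]
  exact hw.continuous

theorem deriv_star_comp (y : ℝ → ℂ) : deriv (fun x => star (y x)) = fun x => star (deriv y x) :=
  funext fun _ => deriv.star

theorem IsRegular.star {y : ℝ → ℂ} (hy : IsRegular y) : IsRegular (fun x => star (y x)) :=
  .of_hasDerivAt (fun x => (hy.hasDerivAt x).star) hy.acloc_deriv.star

theorem tau_star (q : ℝ → ℝ) (y : ℝ → ℂ) :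
    tau q (fun x => star (y x)) = fun x => star (tau q y x) := by
  funext x
  rw [tau, tau, deriv_star_comp, deriv_star_comp, star_sub, star_neg, star_mul',
    Complex.star_def, Complex.conj_ofReal]

theorem IsSolution.star {q : ℝ → ℝ} {z : ℂ} {y : ℝ → ℂ} (hy : IsSolution q z y) :
    IsSolution q (star z) (fun x => star (y x)) := by
  refine ⟨hy.1.star, ?_⟩
  filter_upwards [hy.2] with x hx
  rw [tau_star, ← star_mul', ← star_sub, hx, star_zero]

theorem IsSolution.deriv_deriv {q : ℝ → ℝ} {z : ℂ} {y : ℝ → ℂ} (hy : IsSolution q z y) :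
    ∀ᵐ x, HasDerivAt (deriv y) (-(q x + z) * y x) x := by
  filter_upwards [hy.2, hy.1.ae_hasDerivAt_deriv] with x hx hd
  have : deriv (deriv y) x = -(q x + z) * y x := by
    simp only [tau] at hx
    linear_combination -hx
  rwa [this] at hd

/-- The Wronskian of two solutions is constant. -/
theorem IsSolution.wronskian_eq {q : ℝ → ℝ} {z : ℂ} {y w : ℝ → ℂ} (hy : IsSolution q z y)
    (hw : IsSolution q z w) (a b : ℝ) :
    y a * deriv w a - deriv y a * w a = y b * deriv w b - deriv y b * w b := by
  refine ((hy.1.acloc.mul hw.1.acloc_deriv).sub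
    (hy.1.acloc_deriv.mul hw.1.acloc)).eq_of_ae_hasDerivAt_zero ?_ a b
  filter_upwards [hy.deriv_deriv, hw.deriv_deriv] with x h1 h2
  have h := ((hy.1.hasDerivAt x).mul h2).sub (h1.mul (hw.1.hasDerivAt x))
  refine h.congr_deriv ?_
  ring

theorem IsSolution.memLp {q : ℝ → ℝ} (htop : LimitCircleAtTop q) (hbot : LimitCircleAtBot q)
    {z : ℂ} {y : ℝ → ℂ} (hy : IsSolution q z y) : MemLp y 2 (volume : Measure ℝ) := by
  obtain ⟨a, ha⟩ := htop z y hy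
  obtain ⟨b, hb⟩ := hbot z y hy
  have hc : Continuous y := hy.1.differentiable.continuous
  rw [memLp_two_iff_integrable_sq_norm hc.aestronglyMeasurable] at ha hb ⊢
  rw [← integrableOn_univ]
  have hcc : IntegrableOn (fun x => ‖y x‖ ^ 2) (Icc b a) :=
    (by fun_prop : Continuous fun x => ‖y x‖ ^ 2).continuousOn.integrableOn_compact isCompact_Icc
  refine ((IntegrableOn.union hb hcc).union ha).mono_set fun x _ => ?_
  rcases lt_or_ge x b with h | h
  · exact Or.inl (Or.inl h)
  rcases le_or_gt x a with h' | h'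
  · exact Or.inl (Or.inr ⟨h, h'⟩)
  · exact Or.inr h'

theorem mem_graph_maximalOperator {q : ℝ → ℝ} {f g : L2R} :
    (f, g) ∈ (maximalOperator q).graph ↔
      ∃ y : ℝ → ℂ, IsRegular y ∧ f =ᵐ[volume] y ∧ g =ᵐ[volume] tau q y := by
  rw [maximalOperator_graph]
  rfl

/-- Continuous representatives are unique, so the regular one and the compactly supported one
coincide. -/
theorem mem_graph_preminimalOperator {q : ℝ → ℝ} {f g : L2R} :
    (f, g) ∈ (preminimalOperator q).graph ↔
      ∃ y : ℝ → ℂ, IsRegular y ∧ HasCompactSupport y ∧ f =ᵐ[volume] y ∧ g =ᵐ[volume] tau q y := by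
  have hle : preminimalOperator q ≤ maximalOperator q := LinearPMap.domRestrict_le
  constructor
  · intro h
    obtain ⟨y, hy, hf, hg⟩ := mem_graph_maximalOperator.1 (graph_le_of_le hle h)
    have hdom := LinearPMap.mem_domain_of_mem_graph h
    rw [preminimalOperator, LinearPMap.domRestrict_domain, Submodule.mem_inf] at hdom
    obtain ⟨w, hw, hwc, hfw⟩ := hdom.1
    have : y = w := (Continuous.ae_eq_iff_eq volume hy.1.continuous hw.1.continuous).1
      (hf.symm.trans hfw)
    exact ⟨y, hy, this ▸ hwc, hf, hg⟩
  · rintro ⟨y, hy, hyc, hf, hg⟩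
    have hmax : (f, g) ∈ (maximalOperator q).graph := mem_graph_maximalOperator.2 ⟨y, hy, hf, hg⟩
    refine mem_graph_of_mem_domain_of_le hle ?_ hmax
    rw [preminimalOperator, LinearPMap.domRestrict_domain, Submodule.mem_inf]
    exact ⟨⟨y, hy, hyc, hf⟩, LinearPMap.mem_domain_of_mem_graph hmax⟩

theorem toLp_mem_graph_preminimalOperator {q : ℝ → ℝ} {y w : ℝ → ℂ} (hy : IsRegular y)
    (hyc : HasCompactSupport y) (hy2 : MemLp y 2 (volume : Measure ℝ))
    (hw2 : MemLp w 2 (volume : Measure ℝ)) (h : ∀ᵐ x, tau q y x = w x) :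
    (hy2.toLp y, hw2.toLp w) ∈ (preminimalOperator q).graph :=
  mem_graph_preminimalOperator.2 ⟨y, hy, hyc, hy2.coeFn_toLp, hw2.coeFn_toLp.trans
    (h.mono fun _ hx => hx.symm)⟩

/-- Lagrange's identity: the maximal operator is a formal adjoint of the pre-minimal one. -/
theorem inner_eq_of_mem_graph {q : ℝ → ℝ} {a b f g : L2R}
    (hab : (a, b) ∈ (preminimalOperator q).graph) (hfg : (f, g) ∈ (maximalOperator q).graph) :
    inner ℂ b f = inner ℂ a g := by
  obtain ⟨v, hv, hvc, hav, hbv⟩ := mem_graph_preminimalOperator.1 hab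
  obtain ⟨y, hy, hfy, hgy⟩ := mem_graph_maximalOperator.1 hfg
  rw [← sub_eq_zero, L2.inner_def, L2.inner_def,
    ← integral_sub (L2.integrable_inner b f) (L2.integrable_inner a g)]
  -- The integrand is the derivative of the boundary form `v̄ y' - v̄' y`; the potential terms
  -- cancel because `q` is real.
  refine integral_eq_zero_of_hasDerivAt_of_hasCompactSupport
    (f := fun x => star (v x) * deriv y x - star (deriv v x) * y x)
    ((hv.acloc.star.mul hy.acloc_deriv).sub (hv.acloc_deriv.star.mul hy.acloc))
    ((L2.integrable_inner b f).sub (L2.integrable_inner a g)) ?_ ?_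
  · filter_upwards [hav, hbv, hfy, hgy, hv.ae_hasDerivAt_deriv, hy.ae_hasDerivAt_deriv]
      with x h1 h2 h3 h4 h5 h6
    refine (((hv.hasDerivAt x).star.mul h6).sub (h5.star.mul (hy.hasDerivAt x))).congr_deriv ?_
    simp only [RCLike.inner_apply, h1, h2, h3, h4, tau, map_sub, map_neg, map_mul,
      Complex.conj_ofReal, Complex.star_def]
    ring
  · have h1 : HasCompactSupport fun x => star (v x) := hvc.comp_left (g := star) (star_zero _)
    have h2 : HasCompactSupport fun x => star (deriv v x) :=
      hvc.deriv.comp_left (g := star) (star_zero _)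
    exact (h1.mul_right (f' := deriv y)).sub (h2.mul_right (f' := y))

/-- The primitive starting to the left of the support equals the total integral to its right, and
that is zero. -/
theorem exists_compactly_supported_primitive {g : ℝ → ℂ} (hg : Continuous g)
    (hc : HasCompactSupport g) (h0 : ∫ x, g x = 0) :
    ∃ F : ℝ → ℂ, HasCompactSupport F ∧ ∀ x, HasDerivAt F (g x) x := by
  obtain ⟨R, hR0, hR⟩ := exists_bound_of_hasCompactSupport hc
  refine ⟨fun x => ∫ t in (-R)..x, g t,
    HasCompactSupport.intro (isCompact_Icc (a := -R) (b := R)) fun x hx => ?_,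
    fun x => (hg.integral_hasStrictDerivAt (-R) x).hasDerivAt⟩
  rcases lt_or_ge x (-R) with h | h
  · refine (intervalIntegral.integral_congr (g := fun _ => 0) fun t ht => ?_).trans (by simp)
    rw [uIcc_of_ge h.le] at ht
    exact hR t (by rw [abs_of_nonpos (by linarith [ht.2])]; linarith [ht.2])
  · have hx' : R < x := by
      by_contra hcon
      exact hx ⟨h, not_lt.1 hcon⟩
    rw [intervalIntegral.integral_eq_integral_of_support_subset, h0]
    intro t ht
    have : |t| < R := by
      by_contra hcon
      exact ht (hR t (not_lt.1 hcon))
    rw [abs_lt] at this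
    exact ⟨this.1, this.2.le.trans hx'.le⟩

/-- Variation of constants: solvability of `(τ - z) v = -f` by compactly supported functions. -/
theorem exists_compactly_supported_solution {q : ℝ → ℝ} {z : ℂ} {y w f : ℝ → ℂ}
    (hy : IsSolution q z y) (hw : IsSolution q z w)
    (hW : ∀ x, y x * deriv w x - deriv y x * w x = 1) (hf : Continuous f)
    (hfc : HasCompactSupport f) (hyf : ∫ x, y x * f x = 0) (hwf : ∫ x, w x * f x = 0) :
    ∃ v : ℝ → ℂ, IsRegular v ∧ HasCompactSupport v ∧ ∀ᵐ x, tau q v x = z * v x - f x := by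
  have hyc := hy.1.differentiable.continuous
  have hwc := hw.1.differentiable.continuous
  obtain ⟨F, hFc, hF⟩ := exists_compactly_supported_primitive (hyc.mul hf)
    (hfc.mul_left (f := y)) hyf
  obtain ⟨G, hGc, hG⟩ := exists_compactly_supported_primitive (hwc.mul hf)
    (hfc.mul_left (f := w)) hwf
  simp only [Pi.mul_apply] at hF hG
  have hFac : ACloc F := ACloc.of_contDiff (contDiff_one_iff_deriv.2
    ⟨fun x => (hF x).differentiableAt, by
      rw [show deriv F = fun x => y x * f x from funext fun x => (hF x).deriv]
      exact hyc.mul hf⟩)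
  have hGac : ACloc G := ACloc.of_contDiff (contDiff_one_iff_deriv.2
    ⟨fun x => (hG x).differentiableAt, by
      rw [show deriv G = fun x => w x * f x from funext fun x => (hG x).deriv]
      exact hwc.mul hf⟩)
  -- In the first derivative the terms with `F' = y f` and `G' = w f` cancel; in the second they
  -- contribute the Wronskian times `f`. The moment conditions enter through the compact supports of
  -- `F` and `G`.
  have hd : ∀ x, HasDerivAt (fun x => w x * F x - y x * G x)
      (deriv w x * F x - deriv y x * G x) x := fun x =>
    (((hw.1.hasDerivAt x).mul (hF x)).sub ((hy.1.hasDerivAt x).mul (hG x))).congr_deriv (by ring)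
  refine ⟨fun x => w x * F x - y x * G x, .of_hasDerivAt hd ((hw.1.acloc_deriv.mul hFac).sub
    (hy.1.acloc_deriv.mul hGac)), (hFc.mul_left (f := w)).sub (hGc.mul_left (f := y)), ?_⟩
  filter_upwards [hy.deriv_deriv, hw.deriv_deriv] with x h1 h2
  have h3 := ((h2.mul (hF x)).sub (h1.mul (hG x))).deriv
  have h4 : deriv (fun x => w x * F x - y x * G x)
      = fun x => deriv w x * F x - deriv y x * G x := funext fun x => (hd x).deriv
  have h5 : deriv (fun x => deriv w x * F x - deriv y x * G x) x = _ := h3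
  simp only [tau, h4, h5]
  linear_combination -(f x) * hW x

/-- The product of a solution with a test function lies in the domain of the pre-minimal
operator. -/
theorem mul_mem_domain_preminimalOperator {q : ℝ → ℝ} {z : ℂ} {y : ℝ → ℂ}
    (hy : IsSolution q z y) {g : ℝ → ℂ} (hg : ContDiff ℝ 2 g) (hgc : HasCompactSupport g)
    (hm : MemLp (fun x => y x * g x) 2 (volume : Measure ℝ)) :
    hm.toLp _ ∈ (preminimalOperator q).domain := by
  have hyc := hy.1.differentiable.continuous
  have hyc' := hy.1.acloc_deriv.continuous
  have hg1 : ContDiff ℝ 1 (deriv g) := by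
    have : ContDiff ℝ (1 + 1) g := by simpa [one_add_one_eq_two] using hg
    exact (contDiff_succ_iff_deriv.1 this).2.2
  have hdg : ∀ x, HasDerivAt g (deriv g x) x := fun x =>
    (hg.differentiable (by norm_num) x).hasDerivAt
  have hddg : ∀ x, HasDerivAt (deriv g) (deriv (deriv g) x) x := fun x =>
    (hg1.differentiable (by norm_num) x).hasDerivAt
  have hd : ∀ x, HasDerivAt (fun x => y x * g x) (deriv y x * g x + y x * deriv g x) x := fun x =>
    (hy.1.hasDerivAt x).mul (hdg x)
  have hreg : IsRegular (fun x => y x * g x) := .of_hasDerivAt hd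
    ((hy.1.acloc_deriv.mul (ACloc.of_contDiff (hg.of_le (by norm_num)))).add
      (hy.1.acloc.mul (ACloc.of_contDiff hg1)))
  -- The potential drops out: `τ (y g) = z y g - 2 y' g' - y g''` is continuous even though `q` is
  -- only locally integrable. A bare test function `g` need not have `q g` in `L²`.
  have hwc : Continuous fun x =>
      z * (y x * g x) - (2 * (deriv y x * deriv g x) + y x * deriv (deriv g) x) := by
    have h1 := hg.continuous
    have h2 := hg1.continuous
    have h3 : Continuous (deriv (deriv g)) := hg1.continuous_deriv le_rfl
    fun_prop
  have hws : HasCompactSupport fun x =>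
      z * (y x * g x) - (2 * (deriv y x * deriv g x) + y x * deriv (deriv g) x) :=
    ((hgc.mul_left (f := y)).mul_left (f := fun _ => z)).sub
      (((hgc.deriv.mul_left (f := deriv y)).mul_left (f := fun _ => (2 : ℂ))).add
        (hgc.deriv.deriv.mul_left (f := y)))
  refine LinearPMap.mem_domain_of_mem_graph (toLp_mem_graph_preminimalOperator hreg
    (hgc.mul_left (f := y)) hm (hwc.memLp_of_hasCompactSupport hws) ?_)
  filter_upwards [hy.deriv_deriv] with x h1
  have h2 : deriv (fun x => y x * g x) = fun x => deriv y x * g x + y x * deriv g x :=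
    funext fun x => (hd x).deriv
  have h3 : deriv (fun x => deriv y x * g x + y x * deriv g x) x = _ :=
    ((h1.mul (hdg x)).add ((hy.1.hasDerivAt x).mul (hddg x))).deriv
  simp only [tau, h2, h3]
  ring

/-- A fundamental system of solutions normalized at the origin. -/
theorem exists_fundamental_system {q : ℝ → ℝ} (hq : LocallyIntegrable q volume) (z : ℂ) :
    ∃ y w : ℝ → ℂ, IsSolution q z y ∧ IsSolution q z w ∧ y 0 = 1 ∧ deriv y 0 = 0 ∧ w 0 = 0 ∧
      deriv w 0 = 1 ∧ ∀ x, y x * deriv w x - deriv y x * w x = 1 := by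
  obtain ⟨y, hy, hy0, hy1⟩ := exists_solution hq z 1 0
  obtain ⟨w, hw, hw0, hw1⟩ := exists_solution hq z 0 1
  refine ⟨y, w, hy, hw, hy0, hy1, hw0, hw1, fun x => ?_⟩
  rw [hy.wronskian_eq hw x 0, hy0, hy1, hw0, hw1]
  ring

/-- A vector `u` orthogonal to all products of test functions with two solutions `y`, `w` satisfies
`ȳ u = w̄ u = 0` almost everywhere, and the Wronskian forbids common zeros. -/
theorem dense_domain_preminimalOperator {q : ℝ → ℝ} (hq : LocallyIntegrable q volume) :
    Dense ((preminimalOperator q).domain : Set L2R) := by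
  rw [Submodule.dense_iff_topologicalClosure_eq_top, Submodule.topologicalClosure_eq_top_iff,
    Submodule.eq_bot_iff]
  intro u hu
  obtain ⟨y, w, hy, hw, -, -, -, -, hW⟩ := exists_fundamental_system hq 0
  have key : ∀ {h : ℝ → ℂ}, IsSolution q 0 h → ∀ᵐ x, star (h x) * u x = 0 := by
    intro h hh
    have hhc := hh.1.differentiable.continuous
    have hui : LocallyIntegrable u volume := (Lp.memLp u).locallyIntegrable (by norm_num)
    refine ae_eq_zero_of_integral_contDiff_smul_eq_zero ?_ fun g hg hgc => ?_
    · rw [locallyIntegrable_iff]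
      exact fun k hk => (hui.integrableOn_isCompact hk).continuousOn_mul
        (continuous_star.comp hhc).continuousOn hk
    · have hgC : ContDiff ℝ 2 (fun x => (g x : ℂ)) :=
        Complex.ofRealCLM.contDiff.comp (contDiff_infty.1 hg 2)
      have hgCc : HasCompactSupport (fun x => (g x : ℂ)) :=
        hgc.comp_left (g := fun t : ℝ => (t : ℂ)) Complex.ofReal_zero
      have hm : MemLp (fun x => h x * (g x : ℂ)) 2 (volume : Measure ℝ) :=
        (hhc.mul hgC.continuous).memLp_of_hasCompactSupport (hgCc.mul_left (f := h))
      have h0 := (Submodule.mem_orthogonal _ _).1 hu _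
        (mul_mem_domain_preminimalOperator hh hgC hgCc hm)
      rw [L2.inner_def] at h0
      rw [← h0]
      refine integral_congr_ae ?_
      filter_upwards [hm.coeFn_toLp] with x hx
      rw [hx, RCLike.inner_apply, map_mul, Complex.conj_ofReal, Complex.real_smul,
        Complex.star_def]
      ring
  refine Lp.ext ?_
  filter_upwards [key hy, key hw, Lp.coeFn_zero ℂ 2 (volume : Measure ℝ)] with x h1 h2 h3
  rw [h3, Pi.zero_apply]
  by_contra hne
  have e1 : y x = 0 := by simpa [hne] using h1
  have e2 : w x = 0 := by simpa [hne] using h2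
  simpa [e1, e2] using hW x

theorem preminimalOperator_le_adjoint {q : ℝ → ℝ} (hq : LocallyIntegrable q volume) :
    preminimalOperator q ≤ (preminimalOperator q)† := by
  refine LinearPMap.le_of_le_graph ?_
  rintro ⟨f, g⟩ hfg
  exact (mem_graph_adjoint_iff (dense_domain_preminimalOperator hq)).2 fun a b hab =>
    inner_eq_of_mem_graph hab (graph_le_of_le LinearPMap.domRestrict_le hfg)

theorem isClosable_preminimalOperator {q : ℝ → ℝ} (hq : LocallyIntegrable q volume) :
    (preminimalOperator q).IsClosable :=
  (LinearPMap.adjoint_isClosed (dense_domain_preminimalOperator hq)).isClosable.leIsClosable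
    (preminimalOperator_le_adjoint hq)

theorem graph_minimalOperator {q : ℝ → ℝ} (hq : LocallyIntegrable q volume) :
    (minimalOperator q).graph = (preminimalOperator q).graph.topologicalClosure :=
  (isClosable_preminimalOperator hq).graph_closure_eq_closure_graph.symm

theorem isClosed_minimalOperator {q : ℝ → ℝ} (hq : LocallyIntegrable q volume) :
    (minimalOperator q).IsClosed :=
  (isClosable_preminimalOperator hq).closure_isClosed

theorem dense_domain_minimalOperator {q : ℝ → ℝ} (hq : LocallyIntegrable q volume) :
    Dense ((minimalOperator q).domain : Set L2R) :=
  dense_domain_of_le (dense_domain_preminimalOperator hq) (LinearPMap.le_closure _)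

theorem mem_graph_adjoint_minimalOperator {q : ℝ → ℝ} (hq : LocallyIntegrable q volume)
    {x y : L2R} : (x, y) ∈ (minimalOperator q)†.graph ↔
      ∀ a b, (a, b) ∈ (preminimalOperator q).graph → inner ℂ b x = inner ℂ a y := by
  rw [mem_graph_adjoint_iff (dense_domain_minimalOperator hq)]
  constructor
  · exact fun h a b hab => h a b (graph_le_of_le (LinearPMap.le_closure _) hab)
  · intro h a b hab
    rw [graph_minimalOperator hq] at hab
    have hcl : IsClosed {p : L2R × L2R | inner ℂ p.2 x = inner ℂ p.1 y} :=
      isClosed_eq (by fun_prop) (by fun_prop)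
    exact closure_minimal (fun p hp => h p.1 p.2 hp) hcl hab

theorem minimalOperator_le_adjoint {q : ℝ → ℝ} (hq : LocallyIntegrable q volume) :
    minimalOperator q ≤ (minimalOperator q)† := by
  refine LinearPMap.le_of_le_graph ?_
  rw [graph_minimalOperator hq]
  refine Submodule.topologicalClosure_minimal _ ?_
    (LinearPMap.adjoint_isClosed (dense_domain_minimalOperator hq))
  rintro ⟨f, g⟩ hfg
  exact (mem_graph_adjoint_minimalOperator hq).2 fun a b hab =>
    inner_eq_of_mem_graph hab (graph_le_of_le LinearPMap.domRestrict_le hfg)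

/-- The classes in `L²(ℝ)` of continuous functions with compact support. -/
def compactlySupportedContinuous : Submodule ℂ L2R where
  carrier := {f | ∃ g : ℝ → ℂ, Continuous g ∧ HasCompactSupport g ∧ f =ᵐ[volume] g}
  zero_mem' := ⟨0, continuous_zero, HasCompactSupport.zero, Lp.coeFn_zero _ _ _⟩
  add_mem' := by
    rintro f g ⟨y, hy, hyc, h1⟩ ⟨w, hw, hwc, h2⟩
    exact ⟨y + w, hy.add hw, hyc.add hwc, (Lp.coeFn_add _ _).trans (h1.add h2)⟩
  smul_mem' := by
    rintro c f ⟨y, hy, hyc, h1⟩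
    exact ⟨c • y, hy.const_smul c, hyc.smul_left (f := fun _ => c),
      (Lp.coeFn_smul _ _).trans (h1.const_smul c)⟩

theorem dense_compactlySupportedContinuous :
    Dense (compactlySupportedContinuous : Set L2R) := by
  refine (Lp.dense_hasCompactSupport_contDiff (E := ℝ) (F := ℂ) (μ := volume) (p := 2)
    (by norm_num)).mono ?_
  rintro f ⟨g, hfg, hgc, hg⟩
  exact ⟨g, hg.continuous, hgc, hfg⟩

/-- A functional vanishing on the common kernel of two others is their combination, already on the
dense subspace `D`; density turns this into a relation between vectors. -/
theorem mem_span_pair_of_forall_inner {H : Type*} [NormedAddCommGroup H] [InnerProductSpace ℂ H]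
    {D : Submodule ℂ H} (hD : Dense (D : Set H)) {h₁ h₂ x : H}
    (h : ∀ f ∈ D, inner ℂ h₁ f = 0 → inner ℂ h₂ f = 0 → inner ℂ x f = 0) :
    x ∈ Submodule.span ℂ {h₁, h₂} := by
  let L : H → D →ₗ[ℂ] ℂ := fun k => (innerSL ℂ k).toLinearMap ∘ₗ D.subtype
  have hmem : L x ∈ Submodule.span ℂ (range ![L h₁, L h₂]) := by
    refine mem_span_of_iInf_ker_le_ker fun f hf => ?_
    rw [Submodule.mem_iInf] at hf
    exact h f f.2 (hf 0) (hf 1)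
  rw [Matrix.range_cons, Matrix.range_cons, Matrix.range_empty, union_empty,
    singleton_union] at hmem
  obtain ⟨c, d, hcd⟩ := Submodule.mem_span_pair.1 hmem
  -- The inner product is conjugate linear in its first slot.
  refine Submodule.mem_span_pair.2 ⟨star c, star d, ?_⟩
  refine hD.eq_of_inner_left ℂ fun f hf => ?_
  have := congrArg (fun l => l ⟨f, hf⟩) hcd
  simp only [L, LinearMap.add_apply, LinearMap.smul_apply, LinearMap.comp_apply] at this
  simpa [inner_add_left, inner_smul_left] using this

/-- In the limit circle case all deficiency spaces of the minimal operator have dimension two. -/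
theorem finrank_deficiencySpace_minimalOperator {q : ℝ → ℝ} (hq : LocallyIntegrable q volume)
    (htop : LimitCircleAtTop q) (hbot : LimitCircleAtBot q) (z : ℂ) :
    Module.finrank ℂ (deficiencySpace (minimalOperator q) z) = 2 := by
  obtain ⟨y, w, hy, hw, hy0, hy1, hw0, hw1, hW⟩ := exists_fundamental_system hq z
  have hym := hy.memLp htop hbot
  have hwm := hw.memLp htop hbot
  have hmem : ∀ {h : ℝ → ℂ}, IsSolution q z h → ∀ hm : MemLp h 2 (volume : Measure ℝ),
      hm.toLp h ∈ deficiencySpace (minimalOperator q) z := by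
    intro h hh hm
    refine mem_deficiencySpace.2 ((mem_graph_adjoint_minimalOperator hq).2 fun a b hab =>
      inner_eq_of_mem_graph hab (mem_graph_maximalOperator.2 ⟨h, hh.1, hm.coeFn_toLp, ?_⟩))
    filter_upwards [Lp.coeFn_smul z (hm.toLp h), hm.coeFn_toLp, hh.2] with x h1 h2 h3
    rw [h1, Pi.smul_apply, h2, smul_eq_mul]
    exact (sub_eq_zero.1 h3).symm
  have hspan : deficiencySpace (minimalOperator q) z
      = Submodule.span ℂ {hym.toLp y, hwm.toLp w} := by
    refine le_antisymm (fun x hx => ?_) (Submodule.span_le.2 ?_)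
    · refine mem_span_pair_of_forall_inner dense_compactlySupportedContinuous ?_
      rintro f ⟨g, hg, hgc, hfg⟩ h1 h2
      have hint : ∀ {h : ℝ → ℂ} (hm : MemLp h 2 (volume : Measure ℝ)),
          inner ℂ (hm.toLp h) f = 0 → ∫ t, star (h t) * g t = 0 := by
        intro h hm h0
        rw [← h0, L2.inner_def]
        refine integral_congr_ae ?_
        filter_upwards [hm.coeFn_toLp, hfg] with t ht1 ht2
        rw [ht1, ht2, RCLike.inner_apply, mul_comm, Complex.star_def]
      have hWs : ∀ t, star (y t) * deriv (fun s => star (w s)) t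
          - deriv (fun s => star (y s)) t * star (w t) = 1 := fun t => by
        rw [deriv_star_comp, deriv_star_comp]
        simpa using congrArg star (hW t)
      -- The conjugates solve the equation at `z̄`, so `f` lies in the range of `A₀ - z̄`, to which
      -- `x` is orthogonal.
      obtain ⟨v, hv, hvc, hvτ⟩ := exists_compactly_supported_solution hy.star hw.star hWs hg hgc
        (hint hym h1) (hint hwm h2)
      have hvm : MemLp v 2 (volume : Measure ℝ) :=
        hv.differentiable.continuous.memLp_of_hasCompactSupport hvc
      have hgraph : (hvm.toLp v, star z • hvm.toLp v - f) ∈ (preminimalOperator q).graph := by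
        refine mem_graph_preminimalOperator.2 ⟨v, hv, hvc, hvm.coeFn_toLp, ?_⟩
        filter_upwards [Lp.coeFn_sub (star z • hvm.toLp v) f, Lp.coeFn_smul (star z) (hvm.toLp v),
          hvm.coeFn_toLp, hfg, hvτ] with t e1 e2 e3 e4 e5
        rw [e1, Pi.sub_apply, e2, Pi.smul_apply, e3, e4, e5, smul_eq_mul]
      have h3 := (mem_graph_adjoint_minimalOperator hq).1 (mem_deficiencySpace.1 hx) _ _ hgraph
      rw [inner_sub_left, inner_smul_left, inner_smul_right, Complex.star_def,
        Complex.conj_conj, sub_eq_self] at h3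
      rw [← inner_conj_symm, h3, map_zero]
    · rintro x (rfl | rfl)
      · exact hmem hy hym
      · exact hmem hw hwm
  have hind : LinearIndependent ℂ ![hym.toLp y, hwm.toLp w] := by
    rw [LinearIndependent.pair_iff]
    intro c d hcd
    have hzero : (fun x => c * y x + d * w x) = fun _ => 0 := by
      refine (Continuous.ae_eq_iff_eq volume ?_ continuous_const).1 ?_
      · have h1 := hy.1.differentiable.continuous
        have h2 := hw.1.differentiable.continuous
        fun_prop
      · filter_upwards [Lp.coeFn_add (c • hym.toLp y) (d • hwm.toLp w),
          Lp.coeFn_smul c (hym.toLp y), Lp.coeFn_smul d (hwm.toLp w), hym.coeFn_toLp,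
          hwm.coeFn_toLp, Lp.coeFn_zero ℂ 2 (volume : Measure ℝ)] with x e1 e2 e3 e4 e5 e6
        rw [hcd, e6, Pi.zero_apply, Pi.add_apply, e2, e3, Pi.smul_apply, Pi.smul_apply, e4, e5]
          at e1
        exact e1.symm
    have h0 := congrFun hzero 0
    have h1 : c * deriv y 0 + d * deriv w 0 = 0 := by
      rw [← (((hy.1.hasDerivAt 0).const_mul c).add ((hw.1.hasDerivAt 0).const_mul d)).deriv]
      have : deriv (fun x => c * y x + d * w x) 0 = 0 := by rw [hzero, deriv_const]
      exact this
    exact ⟨by simpa [hy0, hw0] using h0, by simpa [hy1, hw1] using h1⟩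
  have := finrank_span_eq_card hind
  rw [Matrix.range_cons, Matrix.range_cons, Matrix.range_empty, union_empty, singleton_union,
    ← hspan, Fintype.card_fin] at this
  exact this

end PTSymmetric

/-! ### `PT` invariance and a `PT`-symmetric extension -/

namespace PTSymmetric

open Filter Topology

theorem ae_comp_neg {P : ℝ → Prop} (h : ∀ᵐ x, P x) : ∀ᵐ x : ℝ, P (-x) :=
  (Measure.measurePreserving_neg (volume : Measure ℝ)).quasiMeasurePreserving.tendsto_ae.eventually h

theorem coeFn_pt (f : L2R) : pt f =ᵐ[volume] fun x => star (f (-x)) := by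
  have h1 := Lp.coeFn_compMeasurePreserving (timeReversal f)
    (Measure.measurePreserving_neg (volume : Measure ℝ))
  filter_upwards [h1, ae_comp_neg (Lp.coeFn_star f)] with x h2 h3
  exact h2.trans h3

theorem pt_add (f g : L2R) : pt (f + g) = pt f + pt g := by
  refine Lp.ext ?_
  filter_upwards [coeFn_pt (f + g), coeFn_pt f, coeFn_pt g, Lp.coeFn_add (pt f) (pt g),
    ae_comp_neg (Lp.coeFn_add f g)] with x h1 h2 h3 h4 h5
  rw [h1, h4, Pi.add_apply, h2, h3, h5, Pi.add_apply, star_add]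

theorem pt_smul (c : ℂ) (f : L2R) : pt (c • f) = star c • pt f := by
  refine Lp.ext ?_
  filter_upwards [coeFn_pt (c • f), coeFn_pt f, Lp.coeFn_smul (star c) (pt f),
    ae_comp_neg (Lp.coeFn_smul c f)] with x h1 h2 h3 h4
  rw [h1, h3, Pi.smul_apply, h2, h4, Pi.smul_apply, smul_eq_mul, smul_eq_mul, star_mul']

theorem pt_pt (f : L2R) : pt (pt f) = f := by
  refine Lp.ext ?_
  filter_upwards [coeFn_pt (pt f), ae_comp_neg (coeFn_pt f)] with x h1 h2
  rw [h1, h2, star_star, neg_neg]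

theorem inner_pt_pt (f g : L2R) : inner ℂ (pt f) (pt g) = inner ℂ g f := by
  rw [L2.inner_def, L2.inner_def, ← integral_neg_eq_self (fun x => inner ℂ (g x) (f x))]
  refine integral_congr_ae ?_
  filter_upwards [coeFn_pt f, coeFn_pt g] with x h1 h2
  rw [h1, h2, RCLike.inner_apply, RCLike.inner_apply, Complex.star_def,
    Complex.conj_conj, mul_comm]

theorem inner_pt_left (f g : L2R) : inner ℂ (pt f) g = inner ℂ (pt g) f := by
  conv_lhs => rw [← pt_pt g]
  exact inner_pt_pt f (pt g)

theorem pt_sub (f g : L2R) : pt (f - g) = pt f - pt g := by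
  have h := pt_add (f - g) g
  rw [sub_add_cancel] at h
  exact eq_sub_of_add_eq h.symm

theorem norm_pt (f : L2R) : ‖pt f‖ = ‖f‖ := by
  rw [@norm_eq_sqrt_re_inner ℂ _ _ _ _ (pt f), inner_pt_pt, ← norm_eq_sqrt_re_inner]

theorem continuous_pt : Continuous pt :=
  (Isometry.of_dist_eq fun f g => by
    rw [dist_eq_norm, dist_eq_norm, ← pt_sub, norm_pt]).continuous

/-- Reflection changes the sign of `y'` but not of `y''`; an even potential is unaffected by it, and
a real one by conjugation. -/
theorem pt_mem_graph_preminimalOperator {q : ℝ → ℝ} (heven : ∀ x : ℝ, q x = q (-x)) {f g : L2R}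
    (h : (f, g) ∈ (preminimalOperator q).graph) :
    (pt f, pt g) ∈ (preminimalOperator q).graph := by
  obtain ⟨y, hy, hyc, hf, hg⟩ := mem_graph_preminimalOperator.1 h
  have hd : ∀ x, HasDerivAt (fun x => y (-x)) (-deriv y (-x)) x := fun x => by
    have h1 := (hy.hasDerivAt (-x)).scomp x (hasDerivAt_neg x)
    rw [neg_one_smul] at h1
    exact h1
  have hreg : IsRegular (fun x => y (-x)) := .of_hasDerivAt hd hy.acloc_deriv.comp_neg.neg
  have hcs : HasCompactSupport (fun x => y (-x)) :=
    hyc.comp_homeomorph (Homeomorph.neg ℝ)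
  have htau : tau q (fun x => y (-x)) = fun x => tau q y (-x) := by
    funext x
    have h1 : deriv (fun x => y (-x)) = fun x => -deriv y (-x) := funext fun x => (hd x).deriv
    simp only [tau, h1, deriv.fun_neg, deriv_comp_neg, neg_neg, ← heven x]
  refine mem_graph_preminimalOperator.2 ⟨fun x => star (y (-x)), hreg.star,
    hcs.comp_left (g := star) (star_zero _), ?_, ?_⟩
  · filter_upwards [coeFn_pt f, ae_comp_neg hf] with x h1 h2
    rw [h1, h2]
  · filter_upwards [coeFn_pt g, ae_comp_neg hg] with x h1 h2
    rw [h1, h2, tau_star, htau]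

theorem pt_mem_graph_minimalOperator {q : ℝ → ℝ} (hq : LocallyIntegrable q volume)
    (heven : ∀ x : ℝ, q x = q (-x)) {f g : L2R} (h : (f, g) ∈ (minimalOperator q).graph) :
    (pt f, pt g) ∈ (minimalOperator q).graph := by
  rw [graph_minimalOperator hq] at h ⊢
  exact map_mem_closure (f := fun p : L2R × L2R => (pt p.1, pt p.2))
    (by have := continuous_pt; fun_prop) h fun p hp => pt_mem_graph_preminimalOperator heven hp

theorem pt_mem_graph_adjoint_minimalOperator {q : ℝ → ℝ} (hq : LocallyIntegrable q volume)
    (heven : ∀ x : ℝ, q x = q (-x)) {f g : L2R} (h : (f, g) ∈ (minimalOperator q)†.graph) :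
    (pt f, pt g) ∈ (minimalOperator q)†.graph := by
  rw [mem_graph_adjoint_iff (dense_domain_minimalOperator hq)] at h ⊢
  intro a b hab
  have h1 := h _ _ (pt_mem_graph_minimalOperator hq heven hab)
  rw [← inner_conj_symm, inner_pt_left, h1, inner_pt_left, inner_conj_symm]

/-- There is a `PT`-invariant vector in `dom A*` outside `dom A`. -/
theorem exists_pt_invariant_vector {q : ℝ → ℝ} (hq : LocallyIntegrable q volume)
    (heven : ∀ x : ℝ, q x = q (-x)) (htop : LimitCircleAtTop q) (hbot : LimitCircleAtBot q) :
    ∃ v ∈ (minimalOperator q)†.domain, v ∉ (minimalOperator q).domain ∧ pt v = v := by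
  have hN := finrank_deficiencySpace_minimalOperator hq htop hbot
  have : ∀ z, FiniteDimensional ℂ (deficiencySpace (minimalOperator q) z) := fun z =>
    Module.finite_of_finrank_pos (by rw [hN z]; norm_num)
  have hrank := rank_adjoint_domain_quotient (n := 2) (m := 2) (dense_domain_minimalOperator hq)
    (isClosed_minimalOperator hq) (minimalOperator_le_adjoint hq) (hN _) (hN _)
  obtain ⟨u, hu, hu'⟩ : ∃ u ∈ (minimalOperator q)†.domain, u ∉ (minimalOperator q).domain := by
    by_contra! hcon
    have htop : (minimalOperator q).domain.comap (minimalOperator q)†.domain.subtype = ⊤ :=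
      eq_top_iff.2 fun x _ => hcon x x.2
    rw [htop, rank_subsingleton'] at hrank
    norm_num at hrank
  have hptu : pt u ∈ (minimalOperator q)†.domain := by
    obtain ⟨w, hw⟩ := LinearPMap.mem_domain_iff.1 hu
    exact LinearPMap.mem_domain_of_mem_graph (pt_mem_graph_adjoint_minimalOperator hq heven hw)
  -- Both `u + PT u` and `i (u - PT u)` are fixed by the antilinear `PT`, and `u` is a combination
  -- of them, so they cannot both lie in `dom A`.
  by_cases h1 : u + pt u ∈ (minimalOperator q).domain
  · refine ⟨Complex.I • (u - pt u), Submodule.smul_mem _ _ (Submodule.sub_mem _ hu hptu),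
      fun h2 => hu' ?_, ?_⟩
    · have h3 := Submodule.smul_mem _ (1 / 2 : ℂ)
        (Submodule.sub_mem _ h1 (Submodule.smul_mem _ Complex.I h2))
      convert! h3 using 1
      rw [smul_smul, Complex.I_mul_I]
      module
    · rw [pt_smul, pt_sub, pt_pt, Complex.star_def, Complex.conj_I]
      module
  · exact ⟨u + pt u, Submodule.add_mem _ hu hptu, h1, by rw [pt_add, pt_pt, add_comm]⟩

/-- Adjoin a fixed vector `v`: since `PT (c v) = c̄ v`, the domain `dom A + ℂ v` is invariant, and
commutation is inherited from `A*`. -/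
theorem exists_ptSymmetric_biExtension {q : ℝ → ℝ} (hq : LocallyIntegrable q volume)
    (heven : ∀ x : ℝ, q x = q (-x)) (htop : LimitCircleAtTop q) (hbot : LimitCircleAtBot q) :
    ∃ B : L2R →ₗ.[ℂ] L2R, IsBiExtensionOfDim (minimalOperator q) B 1 ∧ IsPTSymmetric B := by
  obtain ⟨v, hvd, hv, hpv⟩ := exists_pt_invariant_vector hq heven htop hbot
  have hs := minimalOperator_le_adjoint hq
  have hB := isBiExtensionOfDim_domRestrict (isClosed_minimalOperator hq) hs hvd hv
  refine ⟨_, hB, hB.1.1, dense_domain_of_le (dense_domain_minimalOperator hq) hB.1.2.1, ?_⟩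
  rintro ⟨f, hf⟩
  have hgraph := pt_mem_graph_adjoint_minimalOperator hq heven
    (graph_le_of_le hB.1.2.2 (LinearPMap.mem_graph _ ⟨f, hf⟩))
  have hdom : pt f ∈ (((minimalOperator q)†).domRestrict
      ((minimalOperator q).domain ⊔ Submodule.span ℂ {v})).domain := by
    rw [LinearPMap.domRestrict_domain, Submodule.mem_inf]
    refine ⟨?_, LinearPMap.mem_domain_of_mem_graph hgraph⟩
    obtain ⟨a, ha, u, hu, rfl⟩ := Submodule.mem_sup.1 hf.1
    obtain ⟨c, rfl⟩ := Submodule.mem_span_singleton.1 hu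
    obtain ⟨b, hab⟩ := LinearPMap.mem_domain_iff.1 ha
    rw [pt_add, pt_smul, hpv]
    exact Submodule.add_mem_sup
      (LinearPMap.mem_domain_of_mem_graph (pt_mem_graph_minimalOperator hq heven hab))
      (Submodule.smul_mem _ _ (Submodule.mem_span_singleton_self v))
  exact ⟨hdom, (LinearPMap.image_iff hdom).2 (mem_graph_of_mem_domain_of_le hB.1.2.2 hdom hgraph)⟩

end PTSymmetric

theorem mainTheorem2 (q : ℝ → ℝ)
    (hq : MeasureTheory.LocallyIntegrable q MeasureTheory.volume)
    (heven : ∀ x : ℝ, q x = q (-x))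
    (htop : PTSymmetric.LimitCircleAtTop q) (hbot : PTSymmetric.LimitCircleAtBot q) :
    (∀ B : PTSymmetric.L2R →ₗ.[ℂ] PTSymmetric.L2R,
      PTSymmetric.IsBiExtensionOfDim (PTSymmetric.minimalOperator q) B 1 →
        PTSymmetric.spectrum B = Set.univ ∧
        PTSymmetric.IsBiExtensionOfDim (PTSymmetric.minimalOperator q) B.adjoint 3 ∧
        PTSymmetric.resolventSet B.adjoint = ∅) ∧
    ∃ B : PTSymmetric.L2R →ₗ.[ℂ] PTSymmetric.L2R,
      PTSymmetric.IsBiExtensionOfDim (PTSymmetric.minimalOperator q) B 1 ∧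
      PTSymmetric.IsPTSymmetric B ∧ PTSymmetric.resolventSet B = ∅ := by
  have key := fun B => PTSymmetric.one_dimensional_biExtension (B := B)
    (PTSymmetric.dense_domain_minimalOperator hq) (PTSymmetric.isClosed_minimalOperator hq)
    (PTSymmetric.minimalOperator_le_adjoint hq)
    (PTSymmetric.finrank_deficiencySpace_minimalOperator hq htop hbot)
  refine ⟨key, ?_⟩
  obtain ⟨B, hB, hpt⟩ := PTSymmetric.exists_ptSymmetric_biExtension hq heven htop hbot
  exact ⟨B, hB, hpt, Set.compl_univ_iff.1 (key B hB).1⟩
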